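/- Let $n\ge 1$. Use the Fourier transform $\mathscr F f(\xi)=\int_{\mathbb R^n}e^{-ix\cdot\xi}f(x)\,dx$ on $\mathscr S'(\mathbb R^n)$. Let $\{\sigma_k\}_{k\in\mathbb Z^n}$ be real-valued smooth functions on $\mathbb R^n$ such that, for some $c>0$ and constants $C_m$: $\sigma_k(\xi)\ge c$ whenever $|\xi_i-k_i|\le 1/2$ for all $i$; $\operatorname{supp}\sigma_k\subset\{|\xi-k|\le\sqrt n\}$; $\sum_k\sigma_k\equiv 1$; and $|D^\alpha\sigma_k|\le C_m$ on $\mathbb R^n$ for all $k$ and all $|\alpha|\le m$, $m\in\mathbb N$. Put $\Box_k=\mathscr F^{-1}\sigma_k\mathscr F$. For $\nu>0$ put $$G_\nu(t)=\mathscr F^{-1}e^{-it|\xi|^2-\nu t|\xi|^2}\mathscr F,\qquad \mathscr A_\nu g(t)=\int_0^tG_\nu(t-\tau)g(\tau)\,d\tau\qquad(t\ge0),$$ where the integral is a weak integral in $\mathscr S'(\mathbb R^n)$. For $p\in\{1,\infty\}$ and $1\le i\le n$, let $$\|F\|_{L^p_{x_i}L^2_{x_j(j\ne i)}L^2_t(\mathbb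 R^+\times\mathbb R^n)}=\Big\|\ \|F\|_{L^2_{t,x_j(j\ne i)}(\mathbb R^+\times\mathbb R^{n-1})}\Big\|_{L^p_{x_i}(\mathbb R)};$$ for a family $(T(t))_{t>0}$ in $\mathscr S'(\mathbb R^n)$, this norm is that of the measurable function $F$ on $\mathbb R^+\times\mathbb R^n$ with $T(t)=F(t,\cdot)$ for almost every $t>0$, and $+\infty$ if there is no such $F$. **Proposition.** There is a constant $C>0$ such that for every $n$, every $\{\sigma_k\}$ as above, every $i\in\{1,\dots,n\}$, $k\in\mathbb Z^n$, $\nu>0$, and every $f:\mathbb R\to\mathscr S'(\mathbb R^n)$ for which $\mathscr A_\nu\partial_{x_i}f(t)$ is defined for all $t\ge0$, $$\|\Box_k\mathscr A_\nu\partial_{x_i}f\|_{L^\infty_{x_i}L^2_{x_j(j\ne i)}L^2_t(\mathbb R^+\times\mathbb R^n)}\le C\,\|\Box_kf\|_{L^1_{x_i}L^2_{x_j(j\ne i)}L^2_t(\mathbb R^+\times\mathbb R^n)}.$$ In particular, $C$ is independent of $\nu$. -/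

import Mathlib

open MeasureTheory Set
open scoped ENNReal SchwartzMap LineDeriv

noncomputable section

namespace GinzburgLandau

/-- The physical space `ℝⁿ` and the frequency space, with the Euclidean norm. -/
abbrev Space (n : ℕ) : Type := EuclideanSpace ℝ (Fin n)

/-- The point of `ℝⁿ` with the integer coordinates `k`. -/
def latticePoint {n : ℕ} (k : Fin n → ℤ) : Space n :=
  WithLp.toLp 2 fun i => (k i : ℝ)

/-- The class `Υ` of smooth frequency-uniform partitions of unity on `ℝⁿ`. -/
structure IsUniformPartition {n : ℕ} (σ : (Fin n → ℤ) → Space n → ℝ) : Prop where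
  smooth : ∀ k, ContDiff ℝ ((⊤ : ℕ∞) : WithTop ℕ∞) (σ k)
  lower : ∃ c : ℝ, 0 < c ∧ ∀ (k : Fin n → ℤ) (ξ : Space n),
    (∀ i, |ξ i - (k i : ℝ)| ≤ 1 / 2) → c ≤ σ k ξ
  support : ∀ k, Function.support (σ k) ⊆ {ξ | ‖ξ - latticePoint k‖ ≤ √(n : ℝ)}
  sum_eq_one : ∀ ξ, HasSum (fun k => σ k ξ) 1
  deriv_bound : ∀ m : ℕ, ∃ C : ℝ, ∀ k ξ, ∀ l ≤ m, ‖iteratedFDeriv ℝ l (σ k) ξ‖ ≤ C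

/-- The Fourier multiplier `𝓕⁻¹ m 𝓕` on tempered distributions, where `𝓕` is the Fourier transform
with kernel `exp (-i x·ξ)`. As Mathlib uses the kernel `exp (-2πi x·ζ)`, the symbol is taken at
`ξ = 2π ζ`. -/
def multiplier {n : ℕ} (m : Space n → ℂ) : 𝓢'(Space n, ℂ) →L[ℂ] 𝓢'(Space n, ℂ) :=
  TemperedDistribution.fourierMultiplierCLM ℂ fun ζ => m ((2 * Real.pi) • ζ)

/-- The frequency-uniform decomposition operator `□_k = 𝓕⁻¹ σ_k 𝓕`. -/
def box {n : ℕ} (σ : (Fin n → ℤ) → Space n → ℝ) (k : Fin n → ℤ) :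
    𝓢'(Space n, ℂ) →L[ℂ] 𝓢'(Space n, ℂ) :=
  multiplier fun ξ => (σ k ξ : ℂ)

/-- The Ginzburg–Landau semigroup `G_ν(t) = 𝓕⁻¹ exp (-i t |ξ|² - ν t |ξ|²) 𝓕`. -/
def semigroup {n : ℕ} (ν t : ℝ) : 𝓢'(Space n, ℂ) →L[ℂ] 𝓢'(Space n, ℂ) :=
  multiplier fun ξ =>
    Complex.exp (-(Complex.I * (t : ℂ) * (‖ξ‖ : ℂ) ^ 2) - (ν : ℂ) * (t : ℂ) * (‖ξ‖ : ℂ) ^ 2)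

/-- `u = 𝒜_ν g`, that is, `u(t) = ∫₀ᵗ G_ν(t - τ) g(τ) dτ` for all `t ≥ 0`, where the integral of
tempered distributions is the weak one: for every test function the scalar integral converges
absolutely and equals the value of `u(t)`. -/
def IsDuhamel {n : ℕ} (ν : ℝ) (g u : ℝ → 𝓢'(Space n, ℂ)) : Prop :=
  ∀ t : ℝ, 0 ≤ t → ∀ φ : 𝓢(Space n, ℂ),
    IntervalIntegrable (fun τ => semigroup ν (t - τ) (g τ) φ) volume 0 t ∧
      u t φ = ∫ τ in (0 : ℝ)..t, semigroup ν (t - τ) (g τ) φ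

/-- The partial derivative `∂_{x_i}` of tempered distributions. -/
def partialDeriv {n : ℕ} (i : Fin n) (T : 𝓢'(Space n, ℂ)) : 𝓢'(Space n, ℂ) :=
  ∂_{EuclideanSpace.single i (1 : ℝ)} T

/-- The tempered distribution `T` is (integration against) the function `h`. -/
def IsGivenBy {n : ℕ} (T : 𝓢'(Space n, ℂ)) (h : Space n → ℂ) : Prop :=
  ∀ φ : 𝓢(Space n, ℂ), Integrable (fun x => φ x * h x) ∧ T φ = ∫ x, φ x * h x

/-- The measurable function `F` on `(0, ∞) × ℝⁿ` represents the family `(T t)_{t > 0}`. -/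
def Represents {n : ℕ} (F : ℝ × Space n → ℂ) (T : ℝ → 𝓢'(Space n, ℂ)) : Prop :=
  AEStronglyMeasurable F ((volume.restrict (Ioi (0 : ℝ))).prod volume) ∧
    ∀ᵐ t ∂(volume.restrict (Ioi (0 : ℝ))), IsGivenBy (T t) fun x => F (t, x)

/-- The anisotropic Lebesgue norm `L^p_{x_i} L²_{x_j (j ≠ i)} L²_t ((0, ∞) × ℝⁿ)`, `n = d + 1`, of
a function of `(t, x)`. In the inner norm `s` is the coordinate `x_i`, and `q` is made up of `t`
and the other `d` coordinates. -/
def anisoNorm {d : ℕ} (p : ℝ≥0∞) (i : Fin (d + 1)) (F : ℝ × Space (d + 1) → ℂ) : ℝ≥0∞ :=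
  eLpNorm (fun s : ℝ =>
    eLpNorm (fun q : ℝ × (Fin d → ℝ) => F (q.1, WithLp.toLp 2 (i.insertNth s q.2))) 2
      ((volume.restrict (Ioi (0 : ℝ))).prod volume)) p volume

/-- The anisotropic Lebesgue norm of a family of tempered distributions: the norm of the function
that represents it (all such functions agree almost everywhere), and `∞` if there is none. -/
def distNorm {d : ℕ} (p : ℝ≥0∞) (i : Fin (d + 1)) (T : ℝ → 𝓢'(Space (d + 1), ℂ)) : ℝ≥0∞ :=
  ⨅ (F : ℝ × Space (d + 1) → ℂ) (_ : Represents F T), anisoNorm p i F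

end GinzburgLandau

end

noncomputable section

namespace GinzburgLandau

open FourierTransform

/-! ### Minkowski's integral inequality in `L²`. -/

section Minkowski

variable {α β : Type*} [MeasurableSpace α] [MeasurableSpace β]

/-! The operator `□_k` enters as a Fourier multiplier with temperate symbol, which commutes with
`G_ν(s) ∂_{x_i}`. So `□_k 𝒜_ν ∂_{x_i} f` is the space-time convolution of `□_k f`, extended by zero
to negative times, with the causal kernel `-2 (γ/s) x_i (γ/(π s))^{n/2} exp (-γ |x|² / s)`, where `γ
= 1 / (4 (ν + i))`.

Freeze `x_i = r` in the kernel. The slice acts by convolution on `L²` in `t` and the other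
coordinates, with norm at most the supremum of its Fourier transform. If this supremum is at most
`M` for all `r`, Minkowski's inequality in `x_i` gives the bound from `L¹_{x_i} L²` to `L^∞_{x_i}
L²` with constant `M` (`eLpNorm_mixed_integral_le`).

The Fourier transform of a slice is explicit (`norm_integral_kernelSlice_le`). The Gaussian integral
in the other coordinates leaves `2 γ (γ/π)^{1/2} r`, up to sign, times `∫ s^{-3/2} exp (-γ r² / s -
s w) ds` with `Re w ≥ 0`. The substitution `u = s^{-1/2}` turns the last integral into twice `∫ exp
(-b u² - w / u²) du`, `b = γ r²`, and `norm_integral_gaussianInv_le` bounds it by its Gaussian value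
at `w = 0`. In total this is at most `√(π / (|γ| r²))`, so the powers of `r` cancel and `M = 2 |γ| ≤
1/2`, uniformly in `ν`.

The slices also have `L¹` norms bounded uniformly in `r`, by a constant that degenerates as `ν → 0`.
That bound serves only for absolute convergence: it justifies Fubini and the identification of the
weak Duhamel integral with the convolution (`represents_box_duhamel`), and does not enter `M`. -/

lemma eLpNorm_two_eq_lintegral {F : Type*} [TopologicalSpace F] [ContinuousENorm F]
    (μ : Measure α) (f : α → F) :
    eLpNorm f 2 μ = (∫⁻ x, ‖f x‖ₑ ^ 2 ∂μ) ^ (1 / 2 : ℝ) := by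
  rw [eLpNorm_eq_lintegral_rpow_enorm_toReal (by norm_num) (by norm_num)]
  simp

/-- Minkowski's integral inequality in `L²`. -/
theorem eLpNorm_two_lintegral_le (μ : Measure α) (ν : Measure β) [SFinite μ] [SFinite ν]
    {f : α → β → ℝ≥0∞} (hf : Measurable (Function.uncurry f)) :
    eLpNorm (fun x => ∫⁻ y, f x y ∂ν) 2 μ ≤ ∫⁻ y, eLpNorm (fun x => f x y) 2 μ ∂ν := by
  have hfx : ∀ x, Measurable (f x) := fun x => hf.comp (measurable_const.prodMk measurable_id)
  have hfy : ∀ y, Measurable fun x => f x y :=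
    fun y => hf.comp (measurable_id.prodMk measurable_const)
  set N : β → ℝ≥0∞ := fun y => eLpNorm (fun x => f x y) 2 μ with hN
  have hNm : Measurable N := by
    simp only [hN, eLpNorm_two_eq_lintegral, enorm_eq_self]
    exact (Measurable.lintegral_prod_left' (f := fun p : α × β => f p.1 p.2 ^ 2)
      (hf.pow_const 2)).pow_const _
  -- The square is written as a double integral over `y, y'`; after Tonelli, Cauchy–Schwarz in `x`
  -- separates the two variables.
  have key : ∫⁻ x, (∫⁻ y, f x y ∂ν) ^ 2 ∂μ ≤ (∫⁻ y, N y ∂ν) ^ 2 := by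
    have m3 : Measurable fun p : (α × β) × β => f p.1.1 p.1.2 * f p.1.1 p.2 :=
      (hf.comp measurable_fst).mul
        (hf.comp ((measurable_fst.comp measurable_fst).prodMk measurable_snd))
    calc ∫⁻ x, (∫⁻ y, f x y ∂ν) ^ 2 ∂μ
        = ∫⁻ x, ∫⁻ y, ∫⁻ y', f x y * f x y' ∂ν ∂ν ∂μ := by
          refine lintegral_congr fun x => ?_
          simp_rw [lintegral_const_mul _ (hfx x)]
          rw [lintegral_mul_const _ (hfx x), sq]
      _ = ∫⁻ y, ∫⁻ x, ∫⁻ y', f x y * f x y' ∂ν ∂μ ∂ν := by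
          rw [lintegral_lintegral_swap]
          exact (Measurable.lintegral_prod_right' m3).aemeasurable
      _ = ∫⁻ y, ∫⁻ y', ∫⁻ x, f x y * f x y' ∂μ ∂ν ∂ν := by
          refine lintegral_congr fun y => ?_
          rw [lintegral_lintegral_swap]
          exact (m3.comp ((measurable_fst.prodMk measurable_const).prodMk
            measurable_snd)).aemeasurable
      _ ≤ ∫⁻ y, ∫⁻ y', N y * N y' ∂ν ∂ν := by
          refine lintegral_mono fun y => lintegral_mono fun y' => ?_
          have := ENNReal.lintegral_mul_le_Lp_mul_Lq μ Real.HolderConjugate.two_two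
            (hfy y).aemeasurable (hfy y').aemeasurable
          simpa [hN, eLpNorm_two_eq_lintegral] using this
      _ = (∫⁻ y, N y ∂ν) ^ 2 := by
          simp_rw [lintegral_const_mul _ hNm]
          rw [lintegral_mul_const _ hNm, sq]
  rw [eLpNorm_two_eq_lintegral]
  simp only [enorm_eq_self]
  calc (∫⁻ x, (∫⁻ y, f x y ∂ν) ^ 2 ∂μ) ^ (1 / 2 : ℝ)
      ≤ ((∫⁻ y, N y ∂ν) ^ 2) ^ (1 / 2 : ℝ) := by gcongr
    _ = ∫⁻ y, N y ∂ν := by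
        rw [← ENNReal.rpow_natCast, ← ENNReal.rpow_mul]
        norm_num

end Minkowski

/-! ### Young's inequality and Plancherel's identity. -/

section Convolution

/-- Young's inequality `L¹ * L² ⊂ L²`, with absolute values inside the integral. -/
theorem eLpNorm_lintegral_conv_le {G : Type*} [AddCommGroup G] [MeasurableSpace G]
    [MeasurableAdd₂ G] [MeasurableNeg G] {μ : Measure G} [SFinite μ] [μ.IsAddLeftInvariant]
    [μ.IsNegInvariant]
    {κ f : G → ℂ} (hκ : Measurable κ) (hf : Measurable f) :
    eLpNorm (fun x => ∫⁻ y, ‖κ (x - y)‖ₑ * ‖f y‖ₑ ∂μ) 2 μ ≤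
      (∫⁻ y, ‖κ y‖ₑ ∂μ) * eLpNorm f 2 μ := by
  have e1 : ∀ x, ∫⁻ y, ‖κ (x - y)‖ₑ * ‖f y‖ₑ ∂μ = ∫⁻ y, ‖κ y‖ₑ * ‖f (x - y)‖ₑ ∂μ := by
    intro x
    rw [← lintegral_sub_left_eq_self _ x]
    simp
  simp_rw [e1]
  have hm : Measurable (Function.uncurry fun x y : G => ‖κ y‖ₑ * ‖f (x - y)‖ₑ) :=
    (hκ.comp measurable_snd).enorm.mul
      (hf.comp (measurable_fst.sub measurable_snd)).enorm
  refine (eLpNorm_two_lintegral_le μ μ hm).trans ?_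
  rw [← lintegral_mul_const _ hκ.enorm]
  refine lintegral_mono fun y => le_of_eq ?_
  have hfy : Measurable fun x => f (x - y) := hf.comp (measurable_id.sub_const y)
  simp only [eLpNorm_two_eq_lintegral, enorm_eq_self, mul_pow]
  rw [lintegral_const_mul _ (hfy.enorm.pow_const 2), ENNReal.mul_rpow_of_nonneg _ _ (by norm_num),
    lintegral_sub_right_eq_self (fun x => ‖f x‖ₑ ^ 2) y, ← ENNReal.rpow_natCast, ← ENNReal.rpow_mul]
  norm_num

variable {E : Type*} [NormedAddCommGroup E] [InnerProductSpace ℝ E] [FiniteDimensional ℝ E]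
  [MeasurableSpace E] [BorelSpace E]

/-- On `L¹ ∩ L²` the Fourier transform of `L²` is given by the Fourier integral. -/
theorem fourier_toLp_ae_eq {g : E → ℂ} (hg : Integrable g) (hg2 : MemLp g 2) :
    (𝓕 (hg2.toLp g) : Lp ℂ 2 (volume : Measure E)) =ᵐ[volume] 𝓕 g := by
  have hcont : Continuous (𝓕 g) :=
    VectorFourier.fourierIntegral_continuous Real.continuous_fourierChar continuous_inner hg
  refine ae_eq_of_integral_contDiff_smul_eq ((Lp.memLp _).locallyIntegrable (by norm_num))
    -- Both sides are locally integrable, so it suffices to test against smooth compactly supported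
    -- functions; there the identity is the multiplication formula `∫ 𝓕ψ g = ∫ ψ 𝓕g`.
    hcont.locallyIntegrable fun φ hφ hφc => ?_
  let ψ : 𝓢(E, ℂ) := (hφc.comp_left Complex.ofReal_zero).toSchwartzMap
    (Complex.ofRealCLM.contDiff.comp hφ)
  have hψ : ∀ x, ψ x = (φ x : ℂ) := fun x => rfl
  have h1 := congrArg (fun T : 𝓢'(E, ℂ) => T ψ)
    (MeasureTheory.Lp.fourier_toTemperedDistribution_eq (hg2.toLp g))
  simp only [TemperedDistribution.fourier_apply, Lp.toTemperedDistribution_apply] at h1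
  have h2 : ∫ x, 𝓕 ψ x • g x = ∫ x, ψ x • 𝓕 g x := by
    simpa using! VectorFourier.integral_bilin_fourierIntegral_eq_flip
      (ContinuousLinearMap.lsmul ℂ ℂ) (L := innerₗ E) Real.continuous_fourierChar continuous_inner
      ψ.integrable hg
  calc ∫ x, φ x • (𝓕 (hg2.toLp g) : Lp ℂ 2 (volume : Measure E)) x
      = ∫ x, ψ x • (𝓕 (hg2.toLp g) : Lp ℂ 2 (volume : Measure E)) x := by
        simp [hψ]
    _ = ∫ x, 𝓕 ψ x • (hg2.toLp g) x := h1.symm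
    _ = ∫ x, 𝓕 ψ x • g x := integral_congr_ae (by
        filter_upwards [hg2.coeFn_toLp] with x hx
        rw [hx])
    _ = ∫ x, φ x • 𝓕 g x := by rw [h2]; simp [hψ]

theorem eLpNorm_fourier_eq {g : E → ℂ} (hg : Integrable g) (hg2 : MemLp g 2) :
    eLpNorm (𝓕 g) 2 volume = eLpNorm g 2 volume := by
  have h := MeasureTheory.Lp.norm_fourier_eq (hg2.toLp g)
  rw [← eLpNorm_congr_ae (fourier_toLp_ae_eq hg hg2), ← eLpNorm_congr_ae hg2.coeFn_toLp]
  rw [Lp.norm_def, Lp.norm_def] at h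
  exact (ENNReal.toReal_eq_toReal_iff' (Lp.eLpNorm_ne_top _) (Lp.eLpNorm_ne_top _)).1 h

end Convolution
end GinzburgLandau

/-! ### Convolution operators on `L²` and the supremum of the Fourier transform of the kernel. -/

namespace GinzburgLandau

open FourierTransform

lemma ae_lt_top_of_eLpNorm_two {α : Type*} [MeasurableSpace α] {μ : Measure α} {h : α → ℝ≥0∞}
    (hm : Measurable h) (hh : eLpNorm h 2 μ ≠ ∞) : ∀ᵐ x ∂μ, h x < ∞ := by
  rw [eLpNorm_two_eq_lintegral] at hh
  simp only [enorm_eq_self] at hh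
  have h2 : ∫⁻ x, h x ^ 2 ∂μ ≠ ∞ := by
    intro h0
    rw [h0] at hh
    norm_num at hh
  filter_upwards [ae_lt_top (hm.pow_const 2) h2] with x hx
  by_contra h0
  rw [not_lt, top_le_iff] at h0
  simp [h0] at hx

section Group

variable {G : Type*} [AddCommGroup G] [MeasurableSpace G]
    [MeasurableAdd₂ G] [MeasurableNeg G] {μ : Measure G} [SFinite μ] {κ f : G → ℂ}

lemma measurable_lintegral_conv (hκ : Measurable κ) (hf : Measurable f) :
    Measurable fun x => ∫⁻ y, ‖κ (x - y)‖ₑ * ‖f y‖ₑ ∂μ :=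
  Measurable.lintegral_prod_right' (f := fun p : G × G => ‖κ (p.1 - p.2)‖ₑ * ‖f p.2‖ₑ)
    ((hκ.comp (measurable_fst.sub measurable_snd)).enorm.mul (hf.comp measurable_snd).enorm)

lemma aestronglyMeasurable_conv (hκ : Measurable κ) (hf : Measurable f) :
    AEStronglyMeasurable (fun x => ∫ y, κ (x - y) * f y ∂μ) μ := by
  have h : Measurable fun p : G × G => κ (p.1 - p.2) * f p.2 :=
    (hκ.comp (measurable_fst.sub measurable_snd)).mul (hf.comp measurable_snd)
  exact (h.stronglyMeasurable.integral_prod_right (ν := μ)).aestronglyMeasurable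

variable [μ.IsAddLeftInvariant] [μ.IsNegInvariant]

lemma eLpNorm_conv_le (hκ : Measurable κ) (hf : Measurable f) :
    eLpNorm (fun x => ∫ y, κ (x - y) * f y ∂μ) 2 μ ≤ (∫⁻ y, ‖κ y‖ₑ ∂μ) * eLpNorm f 2 μ := by
  refine le_trans (eLpNorm_mono_enorm fun x => ?_) (eLpNorm_lintegral_conv_le hκ hf)
  simp only [enorm_eq_self, ← enorm_mul]
  exact enorm_integral_le_lintegral_enorm _

lemma ae_integrable_conv (hκ : Measurable κ) (hκ1 : Integrable κ μ) (hf : Measurable f)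
    (hf2 : MemLp f 2 μ) : ∀ᵐ x ∂μ, Integrable (fun y => κ (x - y) * f y) μ := by
  have h1 := ae_lt_top_of_eLpNorm_two (measurable_lintegral_conv (μ := μ) hκ hf)
    ((eLpNorm_lintegral_conv_le hκ hf).trans_lt (ENNReal.mul_lt_top hκ1.2 hf2.2)).ne
  filter_upwards [h1] with x hx
  refine ⟨((hκ.comp (measurable_const.sub measurable_id)).mul hf).aestronglyMeasurable, ?_⟩
  simpa only [HasFiniteIntegral, enorm_mul] using hx

end Group

variable {E : Type*} [NormedAddCommGroup E] [InnerProductSpace ℝ E] [FiniteDimensional ℝ E]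
  [MeasurableSpace E] [BorelSpace E]

/-- For `f` in `L¹ ∩ L²` the Fourier integral of the convolution is the pointwise product of Fourier
integrals, and Plancherel applies on both sides. -/
lemma eLpNorm_conv_le_of_integrable {κ f : E → ℂ} (hκ : Measurable κ) (hκ1 : Integrable κ)
    {M : ℝ} (hM : ∀ ξ, ‖𝓕 κ ξ‖ ≤ M) (hf : Measurable f) (hf1 : Integrable f) (hf2 : MemLp f 2) :
    eLpNorm (fun x => ∫ y, κ (x - y) * f y) 2 volume ≤ ENNReal.ofReal M * eLpNorm f 2 volume := by
  have e : (fun x => ∫ y, κ (x - y) * f y) =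
      convolution f κ (ContinuousLinearMap.mul ℂ ℂ) volume := by
    ext x
    simp [convolution, mul_comm]
  have hg1 : Integrable (fun x => ∫ y, κ (x - y) * f y) := by
    rw [e]
    exact hf1.integrable_convolution _ hκ1
  have hg2 : MemLp (fun x => ∫ y, κ (x - y) * f y) 2 :=
    ⟨hg1.1, (eLpNorm_conv_le hκ hf).trans_lt (ENNReal.mul_lt_top hκ1.2 hf2.2)⟩
  rw [← eLpNorm_fourier_eq hg1 hg2, ← eLpNorm_fourier_eq hf1 hf2]
  refine eLpNorm_le_mul_eLpNorm_of_ae_le_mul (Filter.Eventually.of_forall fun ξ => ?_) 2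
  rw [e, Real.fourier_mul_convolution_eq hf1 hκ1, norm_mul, mul_comm]
  gcongr
  exact hM ξ

/-- Convolution with an integrable kernel is bounded on `L²` by the supremum of the Fourier
transform of the kernel. -/
theorem eLpNorm_conv_le_of_norm_fourier_le {κ f : E → ℂ} (hκ : Measurable κ) (hκ1 : Integrable κ)
    {M : ℝ} (hM : ∀ ξ, ‖𝓕 κ ξ‖ ≤ M) (hf : Measurable f) (hf2 : MemLp f 2) :
    eLpNorm (fun x => ∫ y, κ (x - y) * f y) 2 volume ≤ ENNReal.ofReal M * eLpNorm f 2 volume := by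
  set K := ∫⁻ y, ‖κ y‖ₑ with hK
  have hKt : K ≠ ∞ := hκ1.2.ne
  -- Density of continuous compactly supported functions. The remainder is controlled by Young's
  -- inequality, so the `L¹` norm `K` of the kernel appears only in a term that vanishes with `ε`.
  have step : ∀ ε : ℝ≥0∞, ε ≠ 0 → eLpNorm (fun x => ∫ y, κ (x - y) * f y) 2 volume ≤
      ENNReal.ofReal M * (eLpNorm f 2 volume + ε) + K * ε := by
    intro ε hε
    obtain ⟨g, hgc, hfg, hg, hg2⟩ := hf2.exists_hasCompactSupport_eLpNorm_sub_le (by norm_num) hε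
    have hgm := hg.measurable
    have hae : (fun x => ∫ y, κ (x - y) * f y) =ᵐ[volume]
        (fun x => ∫ y, κ (x - y) * g y) + fun x => ∫ y, κ (x - y) * (f - g) y := by
      filter_upwards [ae_integrable_conv hκ hκ1 hgm hg2,
        ae_integrable_conv hκ hκ1 (hf.sub hgm) (hf2.sub hg2)] with x h1 h2
      rw [Pi.add_apply, ← integral_add h1 h2]
      refine integral_congr_ae (Filter.Eventually.of_forall fun y => ?_)
      simp only [Pi.sub_apply]
      ring
    rw [eLpNorm_congr_ae hae]
    refine (eLpNorm_add_le (aestronglyMeasurable_conv hκ hgm)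
      (aestronglyMeasurable_conv hκ (hf.sub hgm)) (by norm_num)).trans ?_
    have h3 : eLpNorm g 2 volume ≤ eLpNorm f 2 volume + ε := by
      have : g = f - (f - g) := by simp
      rw [this]
      refine (eLpNorm_sub_le hf2.1 (hf2.sub hg2).1 (by norm_num)).trans ?_
      gcongr
    refine add_le_add ((eLpNorm_conv_le_of_integrable hκ hκ1 hM hgm
      (hg.integrable_of_hasCompactSupport hgc) hg2).trans ?_) ((eLpNorm_conv_le hκ
      (hf.sub hgm)).trans ?_)
    · gcongr
    · gcongr
  have ht : Filter.Tendsto (fun ε : ℝ≥0∞ => ENNReal.ofReal M * (eLpNorm f 2 volume + ε) + K * ε)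
      (nhdsWithin 0 {0}ᶜ) (nhds (ENNReal.ofReal M * (eLpNorm f 2 volume + 0) + K * 0)) := by
    refine Filter.Tendsto.mono_left ?_ nhdsWithin_le_nhds
    exact (ENNReal.Tendsto.const_mul (tendsto_const_nhds.add Filter.tendsto_id)
      (Or.inr ENNReal.ofReal_ne_top)).add
      (ENNReal.Tendsto.const_mul Filter.tendsto_id (Or.inr hKt))
  have : (nhdsWithin (0 : ℝ≥0∞) {0}ᶜ).NeBot := inferInstance
  simpa using ge_of_tendsto ht (eventually_nhdsWithin_of_forall fun ε hε => step ε hε)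

/-- The point of `ℝ^{d+1}` with `i`-th coordinate `q.1` and remaining coordinates `q.2`. -/
def insertPoint {d : ℕ} (i : Fin (d + 1)) : ℝ × (Fin d → ℝ) ≃ᵐ Space (d + 1) :=
  (MeasurableEquiv.piFinSuccAbove (fun _ : Fin (d + 1) => ℝ) i).symm.trans
    (MeasurableEquiv.toLp 2 (Fin (d + 1) → ℝ))

lemma measurePreserving_insertPoint {d : ℕ} (i : Fin (d + 1)) :
    MeasurePreserving (insertPoint i) :=
  ((volume_preserving_piFinSuccAbove (fun _ : Fin (d + 1) => ℝ) i).symm _).trans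
    (EuclideanSpace.volume_preserving_symm_measurableEquiv_toLp _).symm

lemma insertPoint_apply {d : ℕ} (i : Fin (d + 1)) (q : ℝ × (Fin d → ℝ)) :
    insertPoint i q = WithLp.toLp 2 (i.insertNth q.1 q.2) := by
  simp [insertPoint, MeasurableEquiv.piFinSuccAbove]
  rfl

lemma insertPoint_sub {d : ℕ} (i : Fin (d + 1)) (p q : ℝ × (Fin d → ℝ)) :
    insertPoint i (p - q) = insertPoint i p - insertPoint i q := by
  ext j
  refine Fin.succAboveCases i ?_ (fun j => ?_) j <;> simp [insertPoint_apply]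

/-- The product `ℝ × (Fin d → ℝ)` carries a sup norm and no inner product, so the Fourier bound is
transported from Euclidean space by the measure-preserving map `insertPoint 0`, with the characters
written out. -/
theorem eLpNorm_conv_le_of_norm_integral_cexp_le {d : ℕ} {κ f : ℝ × (Fin d → ℝ) → ℂ}
    (hκ : Measurable κ) (hκ1 : Integrable κ) {M : ℝ}
    (hM : ∀ (a : ℝ) (b : Fin d → ℝ), ‖∫ q, κ q *
      Complex.exp (-(2 * Real.pi * Complex.I) * (q.1 * a + ∑ j, (q.2 j : ℂ) * b j))‖ ≤ M)
    (hf : Measurable f) (hf2 : MemLp f 2) :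
    eLpNorm (fun x => ∫ y, κ (x - y) * f y) 2 volume ≤ ENNReal.ofReal M * eLpNorm f 2 volume := by
  have hp := measurePreserving_insertPoint (0 : Fin (d + 1))
  have hs := hp.symm
  have key := eLpNorm_conv_le_of_norm_fourier_le (E := Space (d + 1)) (M := M)
    (κ := κ ∘ (insertPoint 0).symm) (f := f ∘ (insertPoint 0).symm)
    (hκ.comp (insertPoint 0).symm.measurable) (hs.integrable_comp_of_integrable hκ1) ?_
    (hf.comp (insertPoint 0).symm.measurable) (hf2.comp_measurePreserving hs)
  · rw [eLpNorm_comp_measurePreserving hf2.1 hs] at key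
    rw [← eLpNorm_comp_measurePreserving ?_ hp] at key
    · refine le_trans (le_of_eq ?_) key
      congr 1
      ext x
      simp only [Function.comp_apply]
      rw [← hp.integral_comp']
      refine integral_congr_ae (Filter.Eventually.of_forall fun y => ?_)
      simp [← insertPoint_sub, -Fin.insertNth_zero']
    · exact aestronglyMeasurable_conv (hκ.comp (insertPoint 0).symm.measurable)
        (hf.comp (insertPoint 0).symm.measurable)
  · intro ξ
    rw [Real.fourier_eq', ← hp.integral_comp']
    refine le_trans (le_of_eq ?_) (hM (ξ 0) fun j => ξ j.succ)
    congr 1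
    refine integral_congr_ae (Filter.Eventually.of_forall fun q => ?_)
    simp only [Function.comp_apply, smul_eq_mul, insertPoint_apply]
    rw [mul_comm]
    congr 2
    simp [PiLp.inner_apply, Fin.sum_univ_succ]
    simp only [mul_comm]
    ring

end GinzburgLandau

/-! ### The integral of `exp (-b u² - r² w / u²)` over `u > 0`. -/

namespace GinzburgLandau

open Filter Topology

/-- The integrand of the modified Gaussian integral. -/
def gaussianInv (b w : ℂ) (r u : ℝ) : ℂ :=
  Complex.exp (-b * (u : ℂ) ^ 2 - (r : ℂ) ^ 2 * w / (u : ℂ) ^ 2)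

/-- The modified Gaussian integral. -/
def integralGaussianInv (b w : ℂ) (r : ℝ) : ℂ := ∫ u in Ioi (0 : ℝ), gaussianInv b w r u

lemma norm_gaussianInv (b w : ℂ) (r u : ℝ) :
    ‖gaussianInv b w r u‖ = Real.exp (-b.re * u ^ 2 - r ^ 2 * w.re / u ^ 2) := by
  rw [gaussianInv, Complex.norm_exp]
  congr 1
  have e : -b * (u : ℂ) ^ 2 - (r : ℂ) ^ 2 * w / (u : ℂ) ^ 2 =
      ((u ^ 2 : ℝ) : ℂ) * (-b) - ((r ^ 2 / u ^ 2 : ℝ) : ℂ) * w := by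
    push_cast
    ring
  rw [e, Complex.sub_re, Complex.re_ofReal_mul, Complex.re_ofReal_mul, Complex.neg_re]
  ring

lemma norm_gaussianInv_le (b : ℂ) {w : ℂ} (hw : 0 ≤ w.re) (r u : ℝ) :
    ‖gaussianInv b w r u‖ ≤ Real.exp (-b.re * u ^ 2) := by
  rw [norm_gaussianInv]
  gcongr
  have : 0 ≤ r ^ 2 * w.re / u ^ 2 := by positivity
  linarith

lemma measurable_gaussianInv (b w : ℂ) (r : ℝ) : Measurable (gaussianInv b w r) := by
  unfold gaussianInv
  fun_prop

lemma integrable_gaussianInv {b w : ℂ} (hb : 0 < b.re) (hw : 0 ≤ w.re) (r : ℝ) :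
    Integrable (gaussianInv b w r) :=
  (integrable_exp_neg_mul_sq hb).mono' (measurable_gaussianInv b w r).aestronglyMeasurable
    (Eventually.of_forall fun u => norm_gaussianInv_le b hw r u)

lemma norm_integralGaussianInv_le {b w : ℂ} (hb : 0 < b.re) (hw : 0 ≤ w.re) (r : ℝ) :
    ‖integralGaussianInv b w r‖ ≤ ∫ u in Ioi (0 : ℝ), Real.exp (-b.re * u ^ 2) :=
  norm_integral_le_of_norm_le (integrable_exp_neg_mul_sq hb).integrableOn
    (Eventually.of_forall fun u => norm_gaussianInv_le b hw r u)

/-- The substitution `u ↦ r / u`, done as an inversion and a scaling, exchanges the two terms of the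
exponent; `r / u²` is its Jacobian. -/
lemma integral_gaussianInv_swap (b w : ℂ) {r : ℝ} (hr : 0 < r) :
    ∫ u in Ioi (0 : ℝ), ((r / u ^ 2 : ℝ) : ℂ) * gaussianInv b w r u = integralGaussianInv w b r := by
  have h := integral_comp_rpow_Ioi (fun v => (r : ℂ) * gaussianInv w b r (r * v))
    (p := -1) (by norm_num)
  have h2 := integral_comp_mul_left_Ioi (fun v => (r : ℂ) * gaussianInv w b r v) 0 hr
  rw [h2, mul_zero, integral_const_mul, Complex.real_smul, ← mul_assoc] at h
  rw [integralGaussianInv]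
  have e1 : ((r⁻¹ : ℝ) : ℂ) * (r : ℂ) = 1 := by
    rw [← Complex.ofReal_mul, inv_mul_cancel₀ hr.ne', Complex.ofReal_one]
  rw [e1, one_mul] at h
  rw [← h]
  refine setIntegral_congr_fun measurableSet_Ioi fun u hu => ?_
  have hu' : (u : ℂ) ≠ 0 := Complex.ofReal_ne_zero.2 (ne_of_gt hu)
  have hr' : (r : ℂ) ≠ 0 := Complex.ofReal_ne_zero.2 hr.ne'
  have e2 : u ^ ((-1 : ℝ) - 1) = (u ^ 2)⁻¹ := by
    rw [show (-1 : ℝ) - 1 = -(2 : ℕ) by norm_num, Real.rpow_neg (le_of_lt hu), Real.rpow_natCast]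
  simp only [e2, Real.rpow_neg_one, gaussianInv, abs_neg, abs_one, one_mul, Complex.real_smul]
  rw [← mul_assoc]
  congr 2
  · push_cast
    ring
  · push_cast
    field_simp
    ring

lemma hasDerivAt_gaussianInv (b w : ℂ) (r u : ℝ) :
    HasDerivAt (fun r => gaussianInv b w r u)
      (-(2 * w) * (((r / u ^ 2 : ℝ) : ℂ) * gaussianInv b w r u)) r := by
  have h0 : HasDerivAt (fun r : ℝ => (r : ℂ)) 1 r := Complex.ofRealCLM.hasDerivAt
  have h1 := (((h0.pow 2).mul_const w).div_const ((u : ℂ) ^ 2)).const_sub (-b * (u : ℂ) ^ 2)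
  refine h1.cexp.congr_deriv ?_
  simp only [gaussianInv, Pi.pow_apply]
  push_cast
  ring

/-- Differentiation in `r` brings down the factor `r / u²`, which the substitution above absorbs.
Hence the integrals with parameters `(b, w)` and `(w, b)` satisfy a closed linear system of
differential equations. -/
lemma hasDerivAt_integralGaussianInv {b w : ℂ} (hb : 0 < b.re) (hw : 0 < w.re) {r : ℝ}
    (hr : 0 < r) :
    HasDerivAt (integralGaussianInv b w) (-(2 * w) * integralGaussianInv w b r) r := by
  rw [← integral_gaussianInv_swap b w hr, ← integral_const_mul]
  -- The lower bound of `x² Re w` for `x` in `(r/2, 2r)`. With `y ≤ exp y` it makes the singular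
  -- factor `1 / u²` harmless in the dominating function.
  set c : ℝ := r ^ 2 / 4 * w.re with hc
  have hc0 : 0 < c := by positivity
  refine (hasDerivAt_integral_of_dominated_loc_of_deriv_le (s := Ioo (r / 2) (2 * r))
    (F := fun r u => gaussianInv b w r u)
    (F' := fun r u => -(2 * w) * (((r / u ^ 2 : ℝ) : ℂ) * gaussianInv b w r u))
    (bound := fun u => 2 * ‖w‖ * (2 * r * c⁻¹) * Real.exp (-b.re * u ^ 2))
    (Ioo_mem_nhds (by linarith) (by linarith))
    (Eventually.of_forall fun x => (measurable_gaussianInv b w x).aestronglyMeasurable)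
    (integrable_gaussianInv hb hw.le r).integrableOn
    ?_ ?_ ?_ (Eventually.of_forall fun u x _ => hasDerivAt_gaussianInv b w x u)).2
  · have := measurable_gaussianInv b w r
    exact Measurable.aestronglyMeasurable (by fun_prop)
  · refine Eventually.of_forall fun u x hx => ?_
    have hx0 : 0 < x := by linarith [hx.1]
    rw [norm_mul, norm_mul, norm_neg, norm_mul, Complex.norm_real, Complex.norm_two,
      norm_gaussianInv, mul_assoc (2 * ‖w‖)]
    refine mul_le_mul_of_nonneg_left ?_ (by positivity)
    rw [sub_eq_add_neg, Real.exp_add, mul_comm (Real.exp (-b.re * u ^ 2)), ← mul_assoc]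
    refine mul_le_mul_of_nonneg_right ?_ (Real.exp_pos _).le
    rw [Real.norm_of_nonneg (by positivity)]
    have h1 : c / u ^ 2 ≤ x ^ 2 * w.re / u ^ 2 := by
      rw [hc]
      gcongr
      nlinarith [hx.1]
    have h2 : c / u ^ 2 * Real.exp (-(x ^ 2 * w.re / u ^ 2)) ≤ 1 := by
      rw [Real.exp_neg, ← div_eq_mul_inv, div_le_one (Real.exp_pos _)]
      linarith [Real.add_one_le_exp (x ^ 2 * w.re / u ^ 2)]
    calc x / u ^ 2 * Real.exp (-(x ^ 2 * w.re / u ^ 2))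
        = x * c⁻¹ * (c / u ^ 2 * Real.exp (-(x ^ 2 * w.re / u ^ 2))) := by
          field_simp
      _ ≤ x * c⁻¹ * 1 := by gcongr
      _ ≤ 2 * r * c⁻¹ := by
          rw [mul_one]
          gcongr
          exact hx.2.le
  · exact ((integrable_exp_neg_mul_sq hb).const_mul _).integrableOn

/-- A square root in the sector `|arg| < π/4`; the product of two such roots lies in the right
half-plane, which decides between growth and decay below. -/
lemma exists_sq_eq_of_re_pos {b : ℂ} (hb : 0 < b.re) :
    ∃ β : ℂ, β ^ 2 = b ∧ |β.im| < β.re := by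
  obtain ⟨β, hβ⟩ := IsAlgClosed.exists_pow_nat_eq b (n := 2) (by norm_num)
  have h : β.im ^ 2 < β.re ^ 2 := by
    have : (β ^ 2).re = β.re ^ 2 - β.im ^ 2 := by simp [sq]
    rw [hβ] at this
    linarith
  have h' := sq_lt_sq.1 h
  rcases le_total 0 β.re with h0 | h0
  · exact ⟨β, hβ, by rwa [abs_of_nonneg h0] at h'⟩
  · exact ⟨-β, by rw [neg_sq, hβ], by rwa [abs_of_nonpos h0, ← abs_neg β.im] at h'⟩

lemma mul_re_pos_of_abs_im_lt {β ω : ℂ} (hβ : |β.im| < β.re) (hω : |ω.im| < ω.re) :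
    0 < (β * ω).re := by
  rw [Complex.mul_re]
  have h1 : β.im * ω.im ≤ |β.im| * |ω.im| := by rw [← abs_mul]; exact le_abs_self _
  have h2 : |β.im| * |ω.im| < β.re * ω.re :=
    mul_lt_mul'' hβ hω (abs_nonneg _) (abs_nonneg _)
  linarith

lemma tendsto_integralGaussianInv_zero {b w : ℂ} (hb : 0 < b.re) (hw : 0 ≤ w.re) :
    Tendsto (integralGaussianInv b w) (𝓝[>] 0) (𝓝 ((Real.pi / b) ^ (1 / 2 : ℂ) / 2)) := by
  rw [← integral_gaussian_complex_Ioi hb]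
  refine tendsto_integral_filter_of_dominated_convergence (fun u => Real.exp (-b.re * u ^ 2))
    (Eventually.of_forall fun x => (measurable_gaussianInv b w x).aestronglyMeasurable)
    (Eventually.of_forall fun x => Eventually.of_forall fun u => norm_gaussianInv_le b hw x u)
    (integrable_exp_neg_mul_sq hb).integrableOn (Eventually.of_forall fun u => ?_)
  have h := (hasDerivAt_gaussianInv b w 0 u).continuousAt.tendsto.mono_left
    (nhdsWithin_le_nhds (s := Ioi 0))
  simpa [gaussianInv] using h

lemma eq_mul_exp_of_hasDerivAt {D : ℝ → ℂ} {a : ℂ} (hD : ∀ r, 0 < r → HasDerivAt D (a * D r) r)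
    {r : ℝ} (hr : 0 < r) : D r = D 1 * Complex.exp (a * (r - 1)) := by
  have hd : ∀ x, 0 < x → HasDerivAt (fun x : ℝ => D x * Complex.exp (-a * (x - 1))) 0 x := by
    intro x hx
    have h0 : HasDerivAt (fun r : ℝ => (r : ℂ)) 1 x := Complex.ofRealCLM.hasDerivAt
    have h1 := (hD x hx).mul ((h0.sub_const 1).const_mul (-a)).cexp
    refine h1.congr_deriv ?_
    ring
  have h := isOpen_Ioi.is_const_of_deriv_eq_zero (s := Ioi (0 : ℝ)) isPreconnected_Ioi
    (fun x hx => (hd x hx).differentiableAt.differentiableWithinAt)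
    (fun x hx => (hd x hx).deriv) (mem_Ioi.2 hr) (mem_Ioi.2 one_pos)
  simp only [Complex.ofReal_one, sub_self, mul_zero, Complex.exp_zero, mul_one] at h
  rw [← h, mul_assoc, ← Complex.exp_add]
  simp

/-- With `b = β²` and `w = ω²`, the system reads `A' = -2ω² B`, `B' = -2β² A`. The combination `βA -
ωB` grows like `exp (2βω r)` unless it vanishes, and it is bounded, so it is zero. Then `A' = -2βω
A`, so `|A|` decreases from its limit at `0`, the Gaussian integral. -/
lemma norm_integralGaussianInv_le_of_pos {b w : ℂ} (hb : 0 < b.re) (hw : 0 < w.re) {r : ℝ}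
    (hr : 0 < r) : ‖integralGaussianInv b w r‖ ≤ ‖(Real.pi / b) ^ (1 / 2 : ℂ) / 2‖ := by
  obtain ⟨β, rfl, hβ⟩ := exists_sq_eq_of_re_pos hb
  obtain ⟨ω, rfl, hω⟩ := exists_sq_eq_of_re_pos hw
  have hpos := mul_re_pos_of_abs_im_lt hβ hω
  set A := integralGaussianInv (β ^ 2) (ω ^ 2) with hA
  set B := integralGaussianInv (ω ^ 2) (β ^ 2) with hB
  have hDd : ∀ x, 0 < x → HasDerivAt (fun x => β * A x - ω * B x)
      (2 * (β * ω) * (β * A x - ω * B x)) x := by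
    intro x hx
    refine (((hasDerivAt_integralGaussianInv hb hw hx).const_mul β).sub
      ((hasDerivAt_integralGaussianInv hw hb hx).const_mul ω)).congr_deriv ?_
    rw [← hA, ← hB]
    ring
  have hD1 : β * A 1 - ω * B 1 = 0 := by
    by_contra h0
    have hlim : Tendsto (fun x : ℝ => ‖β * A 1 - ω * B 1‖ * Real.exp (2 * (β * ω).re * (x - 1)))
        atTop atTop := by
      refine Tendsto.const_mul_atTop (norm_pos_iff.2 h0) (Real.tendsto_exp_atTop.comp ?_)
      exact Tendsto.const_mul_atTop (by linarith) (tendsto_atTop_add_const_right _ (-1) tendsto_id)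
    set K := ‖β‖ * (∫ u in Ioi (0 : ℝ), Real.exp (-(β ^ 2).re * u ^ 2)) +
      ‖ω‖ * ∫ u in Ioi (0 : ℝ), Real.exp (-(ω ^ 2).re * u ^ 2) with hK
    obtain ⟨x, hx0, hx⟩ := ((eventually_gt_atTop 0).and (hlim.eventually_gt_atTop K)).exists
    have h1 := eq_mul_exp_of_hasDerivAt hDd hx0
    have h2 : ‖β * A x - ω * B x‖ ≤ K := by
      refine (norm_sub_le _ _).trans ?_
      rw [norm_mul, norm_mul]
      exact add_le_add
        (mul_le_mul_of_nonneg_left (norm_integralGaussianInv_le hb hw.le x) (norm_nonneg _))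
        (mul_le_mul_of_nonneg_left (norm_integralGaussianInv_le hw hb.le x) (norm_nonneg _))
    rw [h1, norm_mul, Complex.norm_exp] at h2
    have e : (2 * (β * ω) * ((x : ℂ) - 1)).re = 2 * (β * ω).re * (x - 1) := by
      rw [show 2 * (β * ω) * ((x : ℂ) - 1) = ((2 * (x - 1) : ℝ) : ℂ) * (β * ω) by push_cast; ring,
        Complex.re_ofReal_mul]
      ring
    rw [e] at h2
    exact absurd h2 (not_le.2 hx)
  have hAB : ∀ x, 0 < x → β * A x = ω * B x := by
    intro x hx
    have := eq_mul_exp_of_hasDerivAt hDd hx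
    rw [hD1, zero_mul] at this
    exact sub_eq_zero.1 this
  have hAd : ∀ x, 0 < x → HasDerivAt A (-(2 * (β * ω)) * A x) x := by
    intro x hx
    convert hasDerivAt_integralGaussianInv hb hw hx using 1
    rw [← hB, show -(2 * ω ^ 2) * B x = -(2 * ω) * (ω * B x) by ring, ← hAB x hx]
    ring
  have hanti : ∀ x ∈ Ioo 0 r, ‖A r‖ ≤ ‖A x‖ := by
    intro x hx
    rw [eq_mul_exp_of_hasDerivAt hAd hr, eq_mul_exp_of_hasDerivAt hAd hx.1, norm_mul, norm_mul,
      Complex.norm_exp, Complex.norm_exp]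
    refine mul_le_mul_of_nonneg_left (Real.exp_le_exp.2 ?_) (norm_nonneg _)
    have e : ∀ y : ℝ, (-(2 * (β * ω)) * ((y : ℂ) - 1)).re = -(2 * (β * ω).re * (y - 1)) := by
      intro y
      rw [show -(2 * (β * ω)) * ((y : ℂ) - 1) = ((-(2 * (y - 1)) : ℝ) : ℂ) * (β * ω) by
        push_cast; ring, Complex.re_ofReal_mul]
      ring
    rw [e, e]
    nlinarith [hx.2]
  refine ge_of_tendsto (tendsto_integralGaussianInv_zero hb hw.le).norm ?_
  filter_upwards [Ioo_mem_nhdsGT hr] with x hx using hanti x hx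

/-- The bound for the modified Gaussian integral by the Gaussian one. -/
theorem norm_integral_gaussianInv_le {b w : ℂ} (hb : 0 < b.re) (hw : 0 ≤ w.re) :
    ‖integralGaussianInv b w 1‖ ≤ √(Real.pi / ‖b‖) / 2 := by
  have e : ‖(Real.pi / b) ^ (1 / 2 : ℂ) / 2‖ = √(Real.pi / ‖b‖) / 2 := by
    rw [norm_div, show (1 / 2 : ℂ) = ((1 / 2 : ℝ) : ℂ) by norm_num, Complex.norm_cpow_real,
      norm_div, Complex.norm_real, Real.norm_of_nonneg Real.pi_pos.le, ← Real.sqrt_eq_rpow,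
      Complex.norm_two]
  rw [← e]
  -- The case `Re w = 0` is reached as the limit of `w + ε`. It does occur: at zero frequency in the
  -- other coordinates `w` is purely imaginary.
  have hlim : Tendsto (fun ε : ℝ => integralGaussianInv b (w + ε) 1) (𝓝[>] 0)
      (𝓝 (integralGaussianInv b w 1)) := by
    refine tendsto_integral_filter_of_dominated_convergence (fun u => Real.exp (-b.re * u ^ 2))
      (Eventually.of_forall fun x => (measurable_gaussianInv b _ 1).aestronglyMeasurable)
      ?_ (integrable_exp_neg_mul_sq hb).integrableOn (Eventually.of_forall fun u => ?_)
    · filter_upwards [self_mem_nhdsWithin] with ε hε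
      exact Eventually.of_forall fun u => norm_gaussianInv_le b
        (by simpa using add_nonneg hw (le_of_lt hε)) 1 u
    · have : Continuous fun ε : ℝ => gaussianInv b (w + ε) 1 u := by
        unfold gaussianInv
        fun_prop
      simpa using (this.tendsto 0).mono_left (nhdsWithin_le_nhds (s := Ioi 0))
  refine le_of_tendsto hlim.norm ?_
  filter_upwards [self_mem_nhdsWithin] with ε hε
  exact norm_integralGaussianInv_le_of_pos hb (by simpa using add_pos_of_nonneg_of_pos hw hε) one_pos

end GinzburgLandau

namespace GinzburgLandau

open Filter Topology

/-! ### The time integral of the kernel, by the substitution `u = s^{-1/2}`. -/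

section Substitution

lemma smul_gaussianInv_rpow (b w : ℂ) {s : ℝ} (hs : 0 < s) :
    (|(-1 / 2 : ℝ)| * s ^ ((-1 / 2 : ℝ) - 1)) • gaussianInv b w 1 (s ^ (-1 / 2 : ℝ)) =
      (1 / 2 : ℂ) * (((s ^ (-3 / 2 : ℝ) : ℝ) : ℂ) * Complex.exp (-b / s - s * w)) := by
  have e1 : (s ^ (-1 / 2 : ℝ)) ^ 2 = s⁻¹ := by
    rw [← Real.rpow_natCast, ← Real.rpow_mul hs.le]
    norm_num [Real.rpow_neg_one]
  have e2 : ((s ^ (-1 / 2 : ℝ) : ℝ) : ℂ) ^ 2 = (s : ℂ)⁻¹ := by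
    rw [← Complex.ofReal_pow, e1, Complex.ofReal_inv]
  rw [gaussianInv, e2, Complex.real_smul, abs_of_neg (by norm_num),
    show (-1 / 2 : ℝ) - 1 = -3 / 2 by norm_num]
  push_cast
  rw [show -b * (s : ℂ)⁻¹ - 1 ^ 2 * w / (s : ℂ)⁻¹ = -b / s - s * w by
    rw [one_pow, one_mul, div_inv_eq_mul, neg_mul, neg_div, div_eq_mul_inv, mul_comm w]]
  ring

lemma integral_rpow_mul_cexp (b w : ℂ) :
    ∫ s in Ioi (0 : ℝ), ((s ^ (-3 / 2 : ℝ) : ℝ) : ℂ) * Complex.exp (-b / s - s * w) =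
      2 * integralGaussianInv b w 1 := by
  have h := integral_comp_rpow_Ioi (gaussianInv b w 1) (p := -1 / 2) (by norm_num)
  rw [integralGaussianInv, ← h,
    setIntegral_congr_fun measurableSet_Ioi (fun s hs => smul_gaussianInv_rpow b w hs),
    integral_const_mul, ← mul_assoc]
  norm_num

lemma integrableOn_rpow_mul_cexp {b w : ℂ} (hb : 0 < b.re) (hw : 0 ≤ w.re) :
    IntegrableOn (fun s : ℝ => ((s ^ (-3 / 2 : ℝ) : ℝ) : ℂ) * Complex.exp (-b / s - s * w))
      (Ioi 0) := by
  have h := (integrableOn_Ioi_comp_rpow_iff (gaussianInv b w 1) (p := -1 / 2) (by norm_num)).2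
    (integrable_gaussianInv hb hw 1).integrableOn
  replace h := h.congr_fun (fun s hs => smul_gaussianInv_rpow b w hs) measurableSet_Ioi
  have h2 := h.const_mul 2
  refine h2.congr (Eventually.of_forall fun s => ?_)
  simp only
  ring

lemma norm_integral_rpow_mul_cexp_le {b w : ℂ} (hb : 0 < b.re) (hw : 0 ≤ w.re) :
    ‖∫ s in Ioi (0 : ℝ), ((s ^ (-3 / 2 : ℝ) : ℝ) : ℂ) * Complex.exp (-b / s - s * w)‖ ≤
      √(Real.pi / ‖b‖) := by
  rw [integral_rpow_mul_cexp, norm_mul, Complex.norm_two]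
  linarith [norm_integral_gaussianInv_le hb hw]

/-- The absolute value of the integrand depends only on `Re b`, and for real `b` and `w = 0` the
integrand is positive, so its `L¹` norm is the absolute value of an integral already estimated. -/
lemma lintegral_enorm_rpow_mul_cexp_le {b : ℂ} (hb : 0 < b.re) :
    ∫⁻ s in Ioi (0 : ℝ), ‖((s ^ (-3 / 2 : ℝ) : ℝ) : ℂ) * Complex.exp (-b / s)‖ₑ ≤
      ENNReal.ofReal √(Real.pi / b.re) := by
  have hbr : 0 < ((b.re : ℝ) : ℂ).re := by simpa
  have hi := integrableOn_rpow_mul_cexp hbr (w := 0) (by simp)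
  have hn : ∀ s ∈ Ioi (0 : ℝ), ((‖((s ^ (-3 / 2 : ℝ) : ℝ) : ℂ) *
      Complex.exp (-(b.re : ℂ) / s - s * 0)‖ : ℝ) : ℂ) = ((s ^ (-3 / 2 : ℝ) : ℝ) : ℂ) *
      Complex.exp (-(b.re : ℂ) / s - s * 0) := by
    intro s hs
    have e : -(b.re : ℂ) / s - s * 0 = ((-b.re / s : ℝ) : ℂ) := by push_cast; ring
    rw [e, ← Complex.ofReal_exp, ← Complex.ofReal_mul, Complex.norm_real, Real.norm_of_nonneg]
    have : 0 ≤ s ^ (-3 / 2 : ℝ) := Real.rpow_nonneg (le_of_lt hs) _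
    positivity
  calc ∫⁻ s in Ioi (0 : ℝ), ‖((s ^ (-3 / 2 : ℝ) : ℝ) : ℂ) * Complex.exp (-b / s)‖ₑ
      = ∫⁻ s in Ioi (0 : ℝ), ‖((s ^ (-3 / 2 : ℝ) : ℝ) : ℂ) *
          Complex.exp (-(b.re : ℂ) / s - s * 0)‖ₑ := by
        refine setLIntegral_congr_fun measurableSet_Ioi fun s _ => ?_
        simp only [← ofReal_norm, norm_mul, Complex.norm_exp]
        rw [mul_zero, sub_zero, Complex.div_ofReal_re, Complex.div_ofReal_re, Complex.neg_re,
          Complex.neg_re, Complex.ofReal_re]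
    _ = ENNReal.ofReal ‖∫ s in Ioi (0 : ℝ), ((s ^ (-3 / 2 : ℝ) : ℝ) : ℂ) *
          Complex.exp (-(b.re : ℂ) / s - s * 0)‖ := by
        rw [← ofReal_integral_norm_eq_lintegral_enorm hi,
          ← setIntegral_congr_fun measurableSet_Ioi hn, integral_complex_ofReal,
          Complex.norm_real, Real.norm_of_nonneg (integral_nonneg fun _ => norm_nonneg _)]
    _ ≤ _ := by
        refine ENNReal.ofReal_le_ofReal ((norm_integral_rpow_mul_cexp_le hbr (by simp)).trans ?_)
        rw [Complex.norm_real, Real.norm_of_nonneg hb.le]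

end Substitution

/-! ### The kernel, its slices `x_i = r`, and their Fourier transforms. -/

section Kernel

variable {d : ℕ}

/-- The Gaussian with Fourier transform `exp (-π² |ζ|² / c)`. -/
def gaussian {n : ℕ} (c : ℂ) (x : Space n) : ℂ :=
  (c / Real.pi) ^ ((n : ℂ) / 2) * Complex.exp (-c * (‖x‖ : ℂ) ^ 2)

/-- The kernel of `∂_{x_i}` composed with the heat semigroup of complex diffusivity `1 / (4γ)`. -/
def kernel (γ : ℂ) (i : Fin (d + 1)) (s : ℝ) (x : Space (d + 1)) : ℂ :=
  if 0 < s then -(2 * (γ / s) * (x i : ℂ)) * gaussian (γ / s) x else 0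

lemma measurable_kernel (γ : ℂ) (i : Fin (d + 1)) :
    Measurable fun p : ℝ × Space (d + 1) => kernel γ i p.1 p.2 := by
  unfold kernel gaussian
  refine Measurable.ite (measurableSet_lt measurable_const measurable_fst) ?_ measurable_const
  fun_prop

lemma ofReal_mul_cpow {r : ℝ} (hr : 0 < r) {x : ℂ} (hx : x ≠ 0) (y : ℂ) :
    ((r : ℂ) * x) ^ y = (r : ℂ) ^ y * x ^ y := by
  have hr' : (r : ℂ) ≠ 0 := Complex.ofReal_ne_zero.2 hr.ne'
  rw [Complex.cpow_def_of_ne_zero (mul_ne_zero hr' hx), Complex.cpow_def_of_ne_zero hr',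
    Complex.cpow_def_of_ne_zero hx, Complex.log_ofReal_mul hr hx, ← Complex.exp_add,
    Complex.ofReal_log hr.le, add_mul]

lemma norm_sq_insertPoint (i : Fin (d + 1)) (r : ℝ) (y : Fin d → ℝ) :
    ((‖insertPoint i (r, y)‖ : ℝ) : ℂ) ^ 2 = (r : ℂ) ^ 2 + ∑ j, (y j : ℂ) ^ 2 := by
  rw [← Complex.ofReal_pow, EuclideanSpace.norm_sq_eq, Fin.sum_univ_succAbove _ i]
  simp [insertPoint_apply]

/-- Separates the normalised Gaussian in the other coordinates. The power `s^{-3/2}` collects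
`s^{-1}` from the derivative and `s^{-1/2}` from the normalisation in the direction `x_i`. -/
lemma kernel_insertPoint {γ : ℂ} (hγ : γ ≠ 0) (i : Fin (d + 1)) {s : ℝ} (hs : 0 < s) (r : ℝ)
    (y : Fin d → ℝ) :
    kernel γ i s (insertPoint i (r, y)) =
      -(2 * γ * (γ / Real.pi) ^ (1 / 2 : ℂ)) * r *
        (((s ^ (-3 / 2 : ℝ) : ℝ) : ℂ) * Complex.exp (-(γ * r ^ 2) / s)) *
        ((γ / s / Real.pi) ^ ((d : ℂ) / 2) * Complex.exp (-(γ / s) * ∑ j, (y j : ℂ) ^ 2)) := by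
  have hs' : (s : ℂ) ≠ 0 := Complex.ofReal_ne_zero.2 hs.ne'
  have hpi : (Real.pi : ℂ) ≠ 0 := Complex.ofReal_ne_zero.2 Real.pi_ne_zero
  have h0 : γ / s / Real.pi ≠ 0 := div_ne_zero (div_ne_zero hγ hs') hpi
  have e1 : (γ / s / Real.pi) ^ (((d + 1 : ℕ) : ℂ) / 2) =
      ((s ^ (-1 / 2 : ℝ) : ℝ) : ℂ) * (γ / Real.pi) ^ (1 / 2 : ℂ) *
        (γ / s / Real.pi) ^ ((d : ℂ) / 2) := by
    rw [show ((d + 1 : ℕ) : ℂ) / 2 = 1 / 2 + (d : ℂ) / 2 by push_cast; ring,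
      Complex.cpow_add _ _ h0]
    congr 1
    rw [show γ / s / Real.pi = ((s⁻¹ : ℝ) : ℂ) * (γ / Real.pi) by push_cast; ring,
      ofReal_mul_cpow (inv_pos.2 hs) (div_ne_zero hγ hpi)]
    congr 1
    rw [neg_div, Real.rpow_neg hs.le, ← Real.inv_rpow hs.le, Complex.ofReal_cpow (inv_pos.2 hs).le]
    norm_num
  have e2 : ((s ^ (-3 / 2 : ℝ) : ℝ) : ℂ) = (s : ℂ)⁻¹ * ((s ^ (-1 / 2 : ℝ) : ℝ) : ℂ) := by
    rw [← Complex.ofReal_inv, ← Complex.ofReal_mul, ← Real.rpow_neg_one, ← Real.rpow_add hs]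
    norm_num
  have e3 : insertPoint i (r, y) i = r := by simp [insertPoint_apply]
  rw [kernel, if_pos hs, gaussian, e1, e2, e3, norm_sq_insertPoint,
    show -(γ / s) * ((r : ℂ) ^ 2 + ∑ j, (y j : ℂ) ^ 2) =
      -(γ * r ^ 2) / s + -(γ / s) * ∑ j, (y j : ℂ) ^ 2 by ring, Complex.exp_add]
  ring

/-- The restriction of the kernel to a hyperplane `x_i = r`, a function of `t` and the other
coordinates. -/
def kernelSlice (γ : ℂ) (i : Fin (d + 1)) (r : ℝ) (q : ℝ × (Fin d → ℝ)) : ℂ :=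
  kernel γ i q.1 (insertPoint i (r, q.2))

lemma measurable_kernelSlice (γ : ℂ) (i : Fin (d + 1)) :
    Measurable fun p : ℝ × (ℝ × (Fin d → ℝ)) => kernelSlice γ i p.1 p.2 :=
  (measurable_kernel γ i).comp (measurable_snd.fst.prodMk
    ((insertPoint i).measurable.comp (measurable_fst.prodMk measurable_snd.snd)))

lemma measurable_kernelSlice_right (γ : ℂ) (i : Fin (d + 1)) (r : ℝ) :
    Measurable (kernelSlice γ i r) :=
  (measurable_kernelSlice γ i).comp (measurable_const.prodMk measurable_id)

lemma kernelSlice_zero {γ : ℂ} (i : Fin (d + 1)) : kernelSlice γ i 0 = 0 := by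
  ext q
  simp [kernelSlice, kernel, insertPoint_apply]

lemma re_div_ofReal_pos {γ : ℂ} (hγ : 0 < γ.re) {s : ℝ} (hs : 0 < s) : 0 < (γ / s).re := by
  rw [Complex.div_ofReal_re]
  positivity

/-- The complex Gaussian is normalised by `γ` but decays like the real one with `Re γ`; the ratio is
independent of `s`. -/
lemma lintegral_enorm_gaussian_pi {γ : ℂ} (hγ : 0 < γ.re) {s : ℝ} (hs : 0 < s) :
    ∫⁻ y : Fin d → ℝ, ‖(γ / s / Real.pi) ^ ((d : ℂ) / 2) *
      Complex.exp (-(γ / s) * ∑ j, (y j : ℂ) ^ 2)‖ₑ =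
      ENNReal.ofReal ((‖γ‖ / γ.re) ^ ((d : ℝ) / 2)) := by
  have hc := re_div_ofReal_pos hγ hs
  set β : ℝ := γ.re / s with hβ
  have hβ0 : 0 < β := by positivity
  have hβr : 0 < ((β : ℝ) : ℂ).re := by simpa
  have hi := GaussianFourier.integrable_cexp_neg_mul_sum_add hβr (fun _ : Fin d => (0 : ℂ))
  have hv := GaussianFourier.integral_cexp_neg_mul_sum_add hβr (fun _ : Fin d => (0 : ℂ))
  simp only [zero_mul, Finset.sum_const_zero, add_zero] at hi hv
  have hreal : ∀ y : Fin d → ℝ, ((‖Complex.exp (-(β : ℂ) * ∑ j, (y j : ℂ) ^ 2)‖ : ℝ) : ℂ) =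
      Complex.exp (-(β : ℂ) * ∑ j, (y j : ℂ) ^ 2) := by
    intro y
    have e : -(β : ℂ) * ∑ j, (y j : ℂ) ^ 2 = ((-β * ∑ j, y j ^ 2 : ℝ) : ℂ) := by push_cast; ring
    rw [e, ← Complex.ofReal_exp, Complex.norm_real, Real.norm_of_nonneg (Real.exp_pos _).le]
  have hnorm : ∀ y : Fin d → ℝ, ‖Complex.exp (-(γ / s) * ∑ j, (y j : ℂ) ^ 2)‖ₑ =
      ‖Complex.exp (-(β : ℂ) * ∑ j, (y j : ℂ) ^ 2)‖ₑ := by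
    intro y
    have e : ∀ c : ℂ, -c * ∑ j, (y j : ℂ) ^ 2 = ((∑ j, y j ^ 2 : ℝ) : ℂ) * (-c) := by
      intro c
      push_cast
      ring
    rw [← ofReal_norm, ← ofReal_norm, Complex.norm_exp, Complex.norm_exp, e, e,
      Complex.re_ofReal_mul, Complex.re_ofReal_mul, Complex.neg_re, Complex.neg_re,
      Complex.div_ofReal_re, Complex.ofReal_re]
  simp only [enorm_mul, hnorm]
  rw [lintegral_const_mul _ (by fun_prop), ← ofReal_integral_norm_eq_lintegral_enorm hi]
  have hv' : ∫ y : Fin d → ℝ, ‖Complex.exp (-(β : ℂ) * ∑ j, (y j : ℂ) ^ 2)‖ =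
      (Real.pi / β) ^ ((d : ℝ) / 2) := by
    rw [← Complex.ofReal_inj, ← integral_complex_ofReal]
    simp only [hreal]
    rw [hv, Complex.ofReal_cpow (by positivity)]
    simp
  rw [hv', ← ofReal_norm, ← ENNReal.ofReal_mul (norm_nonneg _),
    show ((d : ℂ) / 2) = (((d : ℝ) / 2 : ℝ) : ℂ) by push_cast; rfl, Complex.norm_cpow_real,
    ← Real.mul_rpow (norm_nonneg _) (by positivity)]
  congr 2
  rw [norm_div, norm_div, Complex.norm_real, Complex.norm_real, Real.norm_of_nonneg hs.le,
    Real.norm_of_nonneg Real.pi_pos.le, hβ]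
  have := Real.pi_pos
  field_simp

lemma integral_gaussian_pi {γ : ℂ} (hγ : 0 < γ.re) {s : ℝ} (hs : 0 < s) (b : Fin d → ℝ) :
    ∫ y : Fin d → ℝ, (γ / s / Real.pi) ^ ((d : ℂ) / 2) *
      Complex.exp (-(γ / s) * ∑ j, (y j : ℂ) ^ 2) *
        Complex.exp (∑ j, (-(2 * Real.pi * Complex.I) * b j) * (y j : ℂ)) =
      Complex.exp (-s * (Real.pi ^ 2 * (∑ j, (b j : ℂ) ^ 2) / γ)) := by
  have hc := re_div_ofReal_pos hγ hs
  have hγ0 : γ ≠ 0 := by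
    rintro rfl
    simp at hγ
  have hs' : (s : ℂ) ≠ 0 := Complex.ofReal_ne_zero.2 hs.ne'
  have hpi : (Real.pi : ℂ) ≠ 0 := Complex.ofReal_ne_zero.2 Real.pi_ne_zero
  have hv := GaussianFourier.integral_cexp_neg_mul_sum_add hc
    (fun j => -(2 * Real.pi * Complex.I) * (b j : ℂ))
  simp only [mul_assoc _ (Complex.exp _) (Complex.exp _), ← Complex.exp_add]
  rw [integral_const_mul, hv, ← mul_assoc, Fintype.card_fin]
  -- A positive real part keeps the base off the branch cut, so that the complex power of the
  -- inverse is the inverse of the power.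
  have harg : (γ / s / Real.pi).arg ≠ Real.pi := by
    have hre : 0 < (γ / s / Real.pi).re := re_div_ofReal_pos hc Real.pi_pos
    intro h
    rw [Complex.arg_eq_pi_iff] at h
    linarith [h.1]
  have e1 : (γ / s / Real.pi) ^ ((d : ℂ) / 2) * (Real.pi / (γ / s)) ^ ((d : ℂ) / 2) = 1 := by
    rw [← inv_div (γ / (s : ℂ)), Complex.inv_cpow _ _ harg, mul_inv_cancel₀]
    exact Complex.cpow_ne_zero_iff.2 (Or.inl (div_ne_zero (div_ne_zero hγ0 hs') hpi))
  rw [e1, one_mul]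
  congr 1
  simp only [mul_pow, neg_sq, Complex.I_sq, ← Finset.mul_sum]
  field_simp
  ring

lemma re_mul_sq_ofReal (γ : ℂ) (r : ℝ) : (γ * (r : ℂ) ^ 2).re = γ.re * r ^ 2 := by
  rw [← Complex.ofReal_pow, Complex.re_mul_ofReal]

/-- The slices of the kernel are integrable, uniformly in `r`. -/
lemma lintegral_enorm_kernelSlice_le {γ : ℂ} (hγ : 0 < γ.re) (i : Fin (d + 1)) (r : ℝ) :
    ∫⁻ q, ‖kernelSlice γ i r q‖ₑ ≤ ENNReal.ofReal (‖2 * γ * (γ / Real.pi) ^ (1 / 2 : ℂ)‖ *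
      √(Real.pi / γ.re) * (‖γ‖ / γ.re) ^ ((d : ℝ) / 2)) := by
  -- At `r = 0` the exponent `γ r²` loses its positive real part, but the factor `x_i` makes the
  -- slice vanish.
  rcases eq_or_ne r 0 with rfl | hr
  · simp [kernelSlice_zero]
  have hγ0 : γ ≠ 0 := by
    rintro rfl
    simp at hγ
  have hr2 : 0 < (γ * (r : ℂ) ^ 2).re := by
    rw [re_mul_sq_ofReal]
    positivity
  set A : ℂ := 2 * γ * (γ / Real.pi) ^ (1 / 2 : ℂ) with hA
  set g : ℝ := (‖γ‖ / γ.re) ^ ((d : ℝ) / 2) with hg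
  have hinner : ∀ s : ℝ, ∫⁻ y, ‖kernelSlice γ i r (s, y)‖ₑ =
      (Ioi (0 : ℝ)).indicator (fun s => ‖-A * r‖ₑ * ENNReal.ofReal g *
        ‖((s ^ (-3 / 2 : ℝ) : ℝ) : ℂ) * Complex.exp (-(γ * r ^ 2) / s)‖ₑ) s := by
    intro s
    by_cases hs : 0 < s
    · rw [indicator_of_mem (mem_Ioi.2 hs)]
      simp only [kernelSlice, kernel_insertPoint hγ0 i hs]
      rw [← hA]
      simp only [enorm_mul _ ((γ / s / Real.pi) ^ ((d : ℂ) / 2) * _)]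
      rw [lintegral_const_mul _ (by fun_prop), lintegral_enorm_gaussian_pi hγ hs, enorm_mul]
      ring
    · rw [indicator_of_notMem (by simpa using hs)]
      simp [kernelSlice, kernel, hs]
  rw [Measure.volume_eq_prod, lintegral_prod _
    (measurable_kernelSlice_right γ i r).enorm.aemeasurable]
  simp_rw [hinner]
  rw [lintegral_indicator measurableSet_Ioi, lintegral_const_mul _ (by fun_prop)]
  refine (mul_le_mul_right (lintegral_enorm_rpow_mul_cexp_le hr2) _).trans (le_of_eq ?_)
  rw [← ofReal_norm, ← ENNReal.ofReal_mul (norm_nonneg _), ← ENNReal.ofReal_mul (by positivity)]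
  congr 1
  rw [re_mul_sq_ofReal, norm_mul, norm_neg, Complex.norm_real, Real.norm_eq_abs,
    ← div_div, Real.sqrt_div' _ (sq_nonneg r), Real.sqrt_sq_eq_abs]
  have := abs_pos.2 hr
  field_simp

lemma integrable_kernelSlice {γ : ℂ} (hγ : 0 < γ.re) (i : Fin (d + 1)) (r : ℝ) :
    Integrable (kernelSlice γ i r) :=
  ⟨(measurable_kernelSlice_right γ i r).aestronglyMeasurable,
    (lintegral_enorm_kernelSlice_le hγ i r).trans_lt ENNReal.ofReal_lt_top⟩

/-- The Fourier transform of the slices of the kernel is bounded by `2 ‖γ‖`. -/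
theorem norm_integral_kernelSlice_le {γ : ℂ} (hγ : 0 < γ.re) (i : Fin (d + 1)) (r a : ℝ)
    (b : Fin d → ℝ) :
    ‖∫ q, kernelSlice γ i r q *
      Complex.exp (-(2 * Real.pi * Complex.I) * (q.1 * a + ∑ j, (q.2 j : ℂ) * b j))‖ ≤
      2 * ‖γ‖ := by
  rcases eq_or_ne r 0 with rfl | hr
  · simp [kernelSlice_zero]
  have hγ0 : γ ≠ 0 := by
    rintro rfl
    simp at hγ
  have hr2 : 0 < (γ * (r : ℂ) ^ 2).re := by
    rw [re_mul_sq_ofReal]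
    positivity
  set A : ℂ := 2 * γ * (γ / Real.pi) ^ (1 / 2 : ℂ) with hA
  -- The coefficient of `-s` in the exponent: the first term comes from the Gaussian integral in the
  -- other coordinates, the second from the time frequency `a`.
  set w : ℂ := Real.pi ^ 2 * (∑ j, (b j : ℂ) ^ 2) / γ + 2 * Real.pi * Complex.I * a with hw
  have hw0 : 0 ≤ w.re := by
    have e : w = ((Real.pi ^ 2 * ∑ j, b j ^ 2 : ℝ) : ℂ) * γ⁻¹ +
        ((2 * Real.pi * a : ℝ) : ℂ) * Complex.I := by
      rw [hw]
      push_cast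
      ring
    rw [e, Complex.add_re, Complex.re_ofReal_mul, Complex.re_ofReal_mul, Complex.I_re, mul_zero,
      add_zero, Complex.inv_re]
    have : 0 ≤ ∑ j, b j ^ 2 := Finset.sum_nonneg fun _ _ => sq_nonneg _
    have := Complex.normSq_nonneg γ
    positivity
  have hint : Integrable (fun q : ℝ × (Fin d → ℝ) => kernelSlice γ i r q *
      Complex.exp (-(2 * Real.pi * Complex.I) * (q.1 * a + ∑ j, (q.2 j : ℂ) * b j))) := by
    refine (integrable_kernelSlice hγ i r).mul_bdd (c := 1)
      (Measurable.aestronglyMeasurable (by fun_prop)) (Eventually.of_forall fun q => le_of_eq ?_)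
    rw [show -(2 * Real.pi * Complex.I) * (q.1 * a + ∑ j, (q.2 j : ℂ) * b j) =
      ((-(2 * Real.pi) * (q.1 * a + ∑ j, q.2 j * b j) : ℝ) : ℂ) * Complex.I by push_cast; ring,
      Complex.norm_exp_ofReal_mul_I]
  have hinner : ∀ s : ℝ, (∫ y, kernelSlice γ i r (s, y) *
      Complex.exp (-(2 * Real.pi * Complex.I) * (s * a + ∑ j, (y j : ℂ) * b j))) =
      (Ioi (0 : ℝ)).indicator (fun s : ℝ => -A * r *
        (((s ^ (-3 / 2 : ℝ) : ℝ) : ℂ) * Complex.exp (-(γ * r ^ 2) / s - s * w))) s := by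
    intro s
    by_cases hs : 0 < s
    · rw [indicator_of_mem (mem_Ioi.2 hs)]
      have e : ∀ y : Fin d → ℝ, kernelSlice γ i r (s, y) *
          Complex.exp (-(2 * Real.pi * Complex.I) * (s * a + ∑ j, (y j : ℂ) * b j)) =
          -A * r * (((s ^ (-3 / 2 : ℝ) : ℝ) : ℂ) * Complex.exp (-(γ * r ^ 2) / s)) *
            Complex.exp (-(2 * Real.pi * Complex.I) * (s * a)) *
          ((γ / s / Real.pi) ^ ((d : ℂ) / 2) * Complex.exp (-(γ / s) * ∑ j, (y j : ℂ) ^ 2) *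
            Complex.exp (∑ j, (-(2 * Real.pi * Complex.I) * b j) * (y j : ℂ))) := by
        intro y
        have e' : ∑ j, (-(2 * Real.pi * Complex.I) * b j) * (y j : ℂ) =
            -(2 * Real.pi * Complex.I) * ∑ j, (y j : ℂ) * b j := by
          rw [Finset.mul_sum]
          exact Finset.sum_congr rfl fun j _ => by ring
        rw [kernelSlice, kernel_insertPoint hγ0 i hs, mul_add, Complex.exp_add, e', ← hA]
        ring
      simp only [e]
      rw [integral_const_mul, integral_gaussian_pi hγ hs b, hw,
        show -(γ * (r : ℂ) ^ 2) / s - s * (Real.pi ^ 2 * (∑ j, (b j : ℂ) ^ 2) / γ +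
          2 * Real.pi * Complex.I * a) = -(γ * (r : ℂ) ^ 2) / s +
          -(2 * Real.pi * Complex.I) * (s * a) +
          -s * (Real.pi ^ 2 * (∑ j, (b j : ℂ) ^ 2) / γ) by ring, Complex.exp_add, Complex.exp_add]
      ring
    · rw [indicator_of_notMem (by simpa using hs)]
      simp [kernelSlice, kernel, hs]
  rw [Measure.volume_eq_prod] at hint ⊢
  rw [integral_prod _ hint]
  simp only [hinner]
  rw [integral_indicator measurableSet_Ioi, integral_const_mul, norm_mul]
  refine (mul_le_mul_of_nonneg_left (norm_integral_rpow_mul_cexp_le hr2 hw0)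
    (norm_nonneg _)).trans (le_of_eq ?_)
  rw [norm_mul, norm_neg, hA, norm_mul, norm_mul, norm_mul, norm_pow, Complex.norm_two,
    show (1 / 2 : ℂ) = ((1 / 2 : ℝ) : ℂ) by norm_num, Complex.norm_cpow_real, norm_div,
    Complex.norm_real, Complex.norm_real, Real.norm_of_nonneg Real.pi_pos.le,
    ← Real.sqrt_eq_rpow, ← div_div, Real.sqrt_div' _ (sq_nonneg _), Real.sqrt_sq (norm_nonneg _),
    Real.sqrt_div' _ Real.pi_pos.le, Real.sqrt_div' _ (norm_nonneg _)]
  have h1 := norm_pos_iff.2 hr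
  have h2 := Real.sqrt_pos.2 (norm_pos_iff.2 hγ0)
  have h3 := Real.sqrt_pos.2 Real.pi_pos
  field_simp

end Kernel
end GinzburgLandau

namespace GinzburgLandau

open Filter Topology

/-! ### Convolution from `L¹_s L²_q` to `L^∞_s L²_q`. -/

section MixedConvolution

lemma measurable_eLpNorm_two_right {G : Type*} [MeasurableSpace G] {μ : Measure G} [SFinite μ]
    {φ : ℝ → G → ℂ} (hφ : Measurable (Function.uncurry φ)) :
    Measurable fun s => eLpNorm (φ s) 2 μ := by
  simp only [eLpNorm_two_eq_lintegral]
  exact (Measurable.lintegral_prod_right' (f := fun p : ℝ × G => ‖φ p.1 p.2‖ₑ ^ 2)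
    (hφ.enorm.pow_const 2)).pow_const _

variable {G : Type*} [AddCommGroup G] [MeasurableSpace G]
    [MeasurableAdd₂ G] [MeasurableNeg G] {μ : Measure G} [SFinite μ]
    {κ φ : ℝ → G → ℂ}

lemma measurable_mixed_integrand (hκ : Measurable (Function.uncurry κ))
    (hφ : Measurable (Function.uncurry φ)) :
    Measurable fun x : (ℝ × G) × (ℝ × G) => κ (x.1.1 - x.2.1) (x.1.2 - x.2.2) * φ x.2.1 x.2.2 :=
  (hκ.comp ((measurable_fst.fst.sub measurable_snd.fst).prodMk
    (measurable_fst.snd.sub measurable_snd.snd))).mul (hφ.comp measurable_snd)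

lemma measurable_mixed_integrand_left (hκ : Measurable (Function.uncurry κ))
    (hφ : Measurable (Function.uncurry φ)) (s : ℝ) :
    Measurable fun x : (G × ℝ) × G => κ (s - x.1.2) (x.1.1 - x.2) * φ x.1.2 x.2 := by
  have h1 : Measurable fun x : (G × ℝ) × G => (s - x.1.2, x.1.1 - x.2) :=
    (measurable_const.sub measurable_fst.snd).prodMk (measurable_fst.fst.sub measurable_snd)
  have h2 : Measurable fun x : (G × ℝ) × G => (x.1.2, x.2) :=
    measurable_fst.snd.prodMk measurable_snd
  exact (hκ.comp h1).mul (hφ.comp h2)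

lemma measurable_mixed_integrand_right (hκ : Measurable (Function.uncurry κ))
    (hφ : Measurable (Function.uncurry φ)) (s : ℝ) (q : G) :
    Measurable fun p : ℝ × G => κ (s - p.1) (q - p.2) * φ p.1 p.2 := by
  have h1 : Measurable fun p : ℝ × G => (s - p.1, q - p.2) :=
    (measurable_const.sub measurable_fst).prodMk (measurable_const.sub measurable_snd)
  exact (hκ.comp h1).mul hφ

lemma measurable_mixed_lintegral (hκ : Measurable (Function.uncurry κ))
    (hφ : Measurable (Function.uncurry φ)) :
    Measurable fun x : ℝ × G =>
      ∫⁻ p : ℝ × G, ‖κ (x.1 - p.1) (x.2 - p.2) * φ p.1 p.2‖ₑ ∂(volume.prod μ) :=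
  Measurable.lintegral_prod_right' (measurable_mixed_integrand hκ hφ).enorm

variable [μ.IsAddLeftInvariant] [μ.IsNegInvariant]

theorem eLpNorm_mixed_lintegral_le (hκ : Measurable (Function.uncurry κ))
    (hφ : Measurable (Function.uncurry φ)) {K : ℝ≥0∞} (hK : ∀ r, ∫⁻ q, ‖κ r q‖ₑ ∂μ ≤ K) (s : ℝ) :
    eLpNorm (fun q => ∫⁻ p : ℝ × G, ‖κ (s - p.1) (q - p.2) * φ p.1 p.2‖ₑ ∂(volume.prod μ)) 2 μ ≤
      K * ∫⁻ s', eLpNorm (φ s') 2 μ := by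
  have e : ∀ q, ∫⁻ p : ℝ × G, ‖κ (s - p.1) (q - p.2) * φ p.1 p.2‖ₑ ∂(volume.prod μ) =
      ∫⁻ s', ∫⁻ q', ‖κ (s - s') (q - q')‖ₑ * ‖φ s' q'‖ₑ ∂μ := by
    intro q
    rw [lintegral_prod _ (measurable_mixed_integrand_right hκ hφ s q).enorm.aemeasurable]
    simp only [enorm_mul]
  simp_rw [e]
  have hm2 : Measurable (Function.uncurry fun (q : G) (s' : ℝ) =>
      ∫⁻ q', ‖κ (s - s') (q - q')‖ₑ * ‖φ s' q'‖ₑ ∂μ) := by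
    simp only [← enorm_mul]
    exact Measurable.lintegral_prod_right' (measurable_mixed_integrand_left hκ hφ s).enorm
  refine (eLpNorm_two_lintegral_le μ volume hm2).trans ?_
  rw [← lintegral_const_mul _ (measurable_eLpNorm_two_right hφ)]
  refine lintegral_mono fun s' => ?_
  refine (eLpNorm_lintegral_conv_le (hκ.comp (measurable_const.prodMk measurable_id))
    (hφ.comp (measurable_const.prodMk measurable_id))).trans ?_
  exact mul_le_mul_left (hK _) _

/-- The bound `K` on absolute values gives Fubini for almost every `q`. After Fubini the inner
integral is a convolution by the slice `κ (s - s')`, so Minkowski's inequality in `s'` yields the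
sharper constant `M`. -/
theorem eLpNorm_mixed_integral_le (hκ : Measurable (Function.uncurry κ))
    (hφ : Measurable (Function.uncurry φ)) {K : ℝ≥0∞} (hK : ∀ r, ∫⁻ q, ‖κ r q‖ₑ ∂μ ≤ K)
    (hKt : K ≠ ∞) {M : ℝ≥0∞} (hM : ∀ r, ∀ f : G → ℂ, Measurable f → MemLp f 2 μ →
      eLpNorm (fun q => ∫ q', κ r (q - q') * f q' ∂μ) 2 μ ≤ M * eLpNorm f 2 μ)
    (hN : ∫⁻ s', eLpNorm (φ s') 2 μ ≠ ∞) (s : ℝ) :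
    eLpNorm (fun q => ∫ p : ℝ × G, κ (s - p.1) (q - p.2) * φ p.1 p.2 ∂(volume.prod μ)) 2 μ ≤
      M * ∫⁻ s', eLpNorm (φ s') 2 μ := by
  have hW := ae_lt_top_of_eLpNorm_two
    ((measurable_mixed_lintegral (μ := μ) hκ hφ).comp (measurable_prodMk_left (x := s)))
    ((eLpNorm_mixed_lintegral_le hκ hφ hK s).trans_lt
      (ENNReal.mul_lt_top hKt.lt_top hN.lt_top)).ne
  set c : G → ℝ → ℂ := fun q s' => ∫ q', κ (s - s') (q - q') * φ s' q' ∂μ with hc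
  have hcm : Measurable (Function.uncurry fun q s' => ‖c q s'‖ₑ) := by
    refine StronglyMeasurable.enorm (f := Function.uncurry c) ?_
    exact StronglyMeasurable.integral_prod_right'
      (measurable_mixed_integrand_left hκ hφ s).stronglyMeasurable
  have h1 : ∀ᵐ q ∂μ, ‖∫ p : ℝ × G, κ (s - p.1) (q - p.2) * φ p.1 p.2 ∂(volume.prod μ)‖ₑ ≤
      ‖∫⁻ s', ‖c q s'‖ₑ‖ₑ := by
    filter_upwards [hW] with q hq
    have hi : Integrable (fun p : ℝ × G => κ (s - p.1) (q - p.2) * φ p.1 p.2)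
        (volume.prod μ) :=
      ⟨(measurable_mixed_integrand_right hκ hφ s q).aestronglyMeasurable, hq⟩
    rw [integral_prod _ hi, enorm_eq_self]
    exact enorm_integral_le_lintegral_enorm _
  refine (eLpNorm_mono_enorm_ae h1).trans ((eLpNorm_two_lintegral_le μ volume hcm).trans ?_)
  rw [← lintegral_const_mul _ (measurable_eLpNorm_two_right hφ)]
  refine lintegral_mono_ae ?_
  filter_upwards [ae_lt_top (measurable_eLpNorm_two_right (μ := μ) hφ) hN] with s' hs'
  have hφs : Measurable (φ s') := hφ.comp (measurable_const.prodMk measurable_id)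
  rw [eLpNorm_enorm]
  exact hM _ _ hφs ⟨hφs.aestronglyMeasurable, hs'⟩

end MixedConvolution

end GinzburgLandau

namespace GinzburgLandau

open Filter Topology FourierTransform

/-! ### Temperate growth of the symbols and commutation of the multipliers. -/

section Symbols

lemma iteratedDeriv_cexp_const_mul_ofReal (c : ℂ) (n : ℕ) :
    iteratedDeriv n (fun y : ℝ => Complex.exp (c * y)) = fun y : ℝ =>
      c ^ n * Complex.exp (c * y) := by
  induction n with
  | zero => simp
  | succ n ih =>
    rw [iteratedDeriv_succ, ih]
    ext y
    have h0 : HasDerivAt (fun r : ℝ => (r : ℂ)) 1 y := Complex.ofRealCLM.hasDerivAt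
    rw [((h0.const_mul c).cexp.const_mul (c ^ n)).deriv]
    ring

/-- Gaussians `exp (c |x|²)`, `Re c ≤ 0`, have temperate growth. -/
lemma hasTemperateGrowth_cexp_norm_sq {E : Type*} [NormedAddCommGroup E] [InnerProductSpace ℝ E]
    {c : ℂ} (hc : c.re ≤ 0) :
    (fun x : E => Complex.exp (c * ((‖x‖ ^ 2 : ℝ) : ℂ))).HasTemperateGrowth := by
  -- The function `y ↦ exp (c y)` may grow exponentially as `y → -∞`. The range of `|x|²` lies in
  -- the open half-line `y > -1`, where all its derivatives are bounded; openness reduces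
  -- derivatives within the set to ordinary ones.
  have hopen : IsOpen (Ioi (-1 : ℝ)) := isOpen_Ioi
  refine Function.HasTemperateGrowth.comp' (g := fun y : ℝ => Complex.exp (c * y))
    (f := fun x : E => ‖x‖ ^ 2) (t := Ioi (-1)) ?_ hopen.uniqueDiffOn ?_ ?_
    (Function.hasTemperateGrowth_norm_sq E)
  · rintro - ⟨x, rfl⟩
    exact lt_of_lt_of_le (by norm_num) (sq_nonneg ‖x‖)
  · exact ((contDiff_const.mul Complex.ofRealCLM.contDiff).cexp).contDiffOn
  · intro N
    refine ⟨0, (1 + ‖c‖) ^ N * Real.exp (-c.re), by positivity, fun n hn y hy => ?_⟩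
    rw [iteratedFDerivWithin_of_isOpen n hopen hy, norm_iteratedFDeriv_eq_norm_iteratedDeriv,
      iteratedDeriv_cexp_const_mul_ofReal, norm_mul, norm_pow, Complex.norm_exp, pow_zero, mul_one,
      Complex.re_mul_ofReal]
    have h1 : ‖c‖ ^ n ≤ (1 + ‖c‖) ^ N :=
      (pow_le_pow_left₀ (norm_nonneg _) (by linarith) n).trans
        (pow_le_pow_right₀ (by linarith [norm_nonneg c]) hn)
    have h2 : Real.exp (c.re * y) ≤ Real.exp (-c.re) :=
      Real.exp_le_exp.2 (by nlinarith [mem_Ioi.1 hy])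
    exact mul_le_mul h1 h2 (Real.exp_pos _).le (by positivity)

variable {n : ℕ}

lemma semigroup_symbol_eq (ν s : ℝ) (ζ : Space n) :
    Complex.exp (-(Complex.I * (s : ℂ) * (‖(2 * Real.pi) • ζ‖ : ℂ) ^ 2) -
      (ν : ℂ) * (s : ℂ) * (‖(2 * Real.pi) • ζ‖ : ℂ) ^ 2) =
    Complex.exp (-(4 * Real.pi ^ 2 * (ν + Complex.I) * s) * ((‖ζ‖ ^ 2 : ℝ) : ℂ)) := by
  rw [norm_smul, Real.norm_of_nonneg (by positivity)]
  congr 1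
  push_cast
  ring

lemma semigroup_eq (ν s : ℝ) : semigroup (n := n) ν s =
    TemperedDistribution.fourierMultiplierCLM ℂ fun ζ =>
      Complex.exp (-(4 * Real.pi ^ 2 * (ν + Complex.I) * s) * ((‖ζ‖ ^ 2 : ℝ) : ℂ)) := by
  simp only [semigroup, multiplier, semigroup_symbol_eq]

lemma re_semigroup_coeff (ν s : ℝ) :
    (4 * (Real.pi : ℂ) ^ 2 * (ν + Complex.I) * s).re = 4 * Real.pi ^ 2 * ν * s := by
  rw [show 4 * (Real.pi : ℂ) ^ 2 * (ν + Complex.I) * s =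
    ((4 * Real.pi ^ 2 * s : ℝ) : ℂ) * (ν + Complex.I) by push_cast; ring, Complex.re_ofReal_mul]
  simp
  ring

lemma hasTemperateGrowth_semigroup_symbol {ν s : ℝ} (hν : 0 < ν) (hs : 0 ≤ s) :
    (fun ζ : Space n => Complex.exp (-(4 * Real.pi ^ 2 * (ν + Complex.I) * s) *
      ((‖ζ‖ ^ 2 : ℝ) : ℂ))).HasTemperateGrowth := by
  refine hasTemperateGrowth_cexp_norm_sq ?_
  rw [Complex.neg_re, re_semigroup_coeff]
  have : 0 ≤ 4 * Real.pi ^ 2 * ν * s := by positivity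
  linarith

lemma IsUniformPartition.hasTemperateGrowth {σ : (Fin n → ℤ) → Space n → ℝ}
    (hσ : IsUniformPartition σ) (k : Fin n → ℤ) :
    (fun ζ : Space n => (σ k ((2 * Real.pi) • ζ) : ℂ)).HasTemperateGrowth := by
  have hc : HasCompactSupport (σ k) := by
    refine HasCompactSupport.intro (isCompact_closedBall (latticePoint k) √(n : ℝ))
      fun x hx => ?_
    by_contra h0
    exact hx (by simpa [dist_eq_norm] using hσ.support k h0)
  exact Function.Complex.hasTemperateGrowth_ofReal.comp
    ((hc.hasTemperateGrowth (hσ.smooth k)).comp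
      (((2 * Real.pi) • ContinuousLinearMap.id ℝ (Space n)).hasTemperateGrowth))

lemma multiplier_partialDeriv_comm {g : Space n → ℂ} (hg : g.HasTemperateGrowth) (i : Fin n)
    (T : 𝓢'(Space n, ℂ)) :
    TemperedDistribution.fourierMultiplierCLM ℂ g (partialDeriv i T) =
      partialDeriv i (TemperedDistribution.fourierMultiplierCLM ℂ g T) := by
  simp only [partialDeriv, TemperedDistribution.lineDeriv_eq_fourierMultiplierCLM, map_smul]
  rw [TemperedDistribution.fourierMultiplierCLM_fourierMultiplierCLM_apply (by fun_prop) hg,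
    TemperedDistribution.fourierMultiplierCLM_fourierMultiplierCLM_apply hg (by fun_prop), mul_comm g]

lemma box_semigroup_partialDeriv {σ : (Fin n → ℤ) → Space n → ℝ} (hσ : IsUniformPartition σ)
    (k : Fin n → ℤ) {ν s : ℝ} (hν : 0 < ν) (hs : 0 ≤ s) (i : Fin n) (T : 𝓢'(Space n, ℂ)) :
    box σ k (semigroup ν s (partialDeriv i T)) = semigroup ν s (partialDeriv i (box σ k T)) := by
  have h1 := hσ.hasTemperateGrowth k
  have h2 := hasTemperateGrowth_semigroup_symbol (n := n) hν hs
  rw [semigroup_eq, box, multiplier]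
  rw [TemperedDistribution.fourierMultiplierCLM_fourierMultiplierCLM_apply h2 h1,
    ← multiplier_partialDeriv_comm h1,
    TemperedDistribution.fourierMultiplierCLM_fourierMultiplierCLM_apply h1 h2, mul_comm]

end Symbols

/-! ### `G_ν(s) ∂_{x_i}` as an integral operator. -/

section Kernel

/-- The parameter `1 / (4 (ν + i))` of the Ginzburg–Landau kernel. -/
def kernelParam (ν : ℝ) : ℂ := (4 * (ν + Complex.I))⁻¹

lemma ofReal_add_I_ne_zero (ν : ℝ) : (ν : ℂ) + Complex.I ≠ 0 := by
  intro h
  simpa using congrArg Complex.im h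

lemma re_kernelParam_pos {ν : ℝ} (hν : 0 < ν) : 0 < (kernelParam ν).re := by
  rw [kernelParam, Complex.inv_re]
  refine div_pos ?_ (Complex.normSq_pos.2 (mul_ne_zero (by norm_num) (ofReal_add_I_ne_zero ν)))
  simpa using hν

lemma norm_kernelParam_le (ν : ℝ) : ‖kernelParam ν‖ ≤ 1 / 4 := by
  have h : 1 ≤ ‖(ν : ℂ) + Complex.I‖ := by
    simpa using Complex.abs_im_le_norm ((ν : ℂ) + Complex.I)
  rw [kernelParam, norm_inv, norm_mul, one_div, Complex.norm_ofNat]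
  exact inv_anti₀ (by norm_num) (by linarith)

variable {n : ℕ}

lemma norm_gaussian_le {c : ℂ} (hc : 0 < c.re) (x : Space n) :
    ‖gaussian c x‖ ≤ ‖(c / Real.pi) ^ ((n : ℂ) / 2)‖ := by
  rw [gaussian, norm_mul, Complex.norm_exp, ← Complex.ofReal_pow, Complex.re_mul_ofReal,
    Complex.neg_re]
  refine mul_le_of_le_one_right (norm_nonneg _) (Real.exp_le_one_iff.2 ?_)
  have := mul_nonneg hc.le (sq_nonneg ‖x‖)
  linarith

lemma gaussian_neg (c : ℂ) (x : Space n) : gaussian c (-x) = gaussian c x := by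
  simp [gaussian]

lemma hasFDerivAt_gaussian (c : ℂ) (x : Space n) :
    HasFDerivAt (gaussian c) ((-(2 * c) * gaussian c x) •
      Complex.ofRealCLM.comp (innerSL ℝ x)) x := by
  have h1 : HasFDerivAt (fun x : Space n => ‖x‖ ^ 2) (2 • innerSL ℝ x) x :=
    (hasStrictFDerivAt_norm_sq x).hasFDerivAt
  have h2 := (((Complex.ofRealCLM.hasFDerivAt (x := ‖x‖ ^ 2)).comp x h1).const_mul
    (-c)).cexp.const_mul ((c / Real.pi) ^ ((n : ℂ) / 2))
  have e : gaussian c = fun x : Space n => (c / Real.pi) ^ ((n : ℂ) / 2) *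
      Complex.exp (-c * (Complex.ofRealCLM ∘ fun x : Space n => ‖x‖ ^ 2) x) := by
    ext x
    simp [gaussian]
  rw [e]
  refine h2.congr_fderiv ?_
  ext v
  simp
  ring

lemma continuous_gaussian (c : ℂ) : Continuous (gaussian (n := n) c) := by
  unfold gaussian
  fun_prop

lemma fourier_semigroup_symbol {ν s : ℝ} (hν : 0 < ν) (hs : 0 < s) (y w : Space n) :
    𝓕 (fun v : Space n => Complex.exp (-(4 * Real.pi ^ 2 * (ν + Complex.I) * s) *
      (‖v‖ : ℂ) ^ 2 + 2 * Real.pi * Complex.I * (inner ℝ y v : ℝ))) w =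
      gaussian (kernelParam ν / s) (y - w) := by
  have hb : 0 < (4 * (Real.pi : ℂ) ^ 2 * (ν + Complex.I) * s).re := by
    rw [re_semigroup_coeff]
    positivity
  have hpi : (Real.pi : ℂ) ≠ 0 := Complex.ofReal_ne_zero.2 Real.pi_ne_zero
  have hs' : (s : ℂ) ≠ 0 := Complex.ofReal_ne_zero.2 hs.ne'
  have hz := ofReal_add_I_ne_zero ν
  rw [fourier_gaussian_innerProductSpace' hb, gaussian, kernelParam]
  congr 2
  · field_simp
  · simp
  · field_simp

/-- This is the transposed multiplier on test functions. The multiplication formula moves the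
Fourier transform from the reflected test function to the modulated Gaussian symbol, whose transform
is a translated Gaussian. -/
lemma fourier_smul_fourierInv_apply {ν s : ℝ} (hν : 0 < ν) (hs : 0 < s) (φ : 𝓢(Space n, ℂ))
    (y : Space n) :
    𝓕 (SchwartzMap.smulLeftCLM ℂ (fun ζ : Space n => Complex.exp
      (-(4 * Real.pi ^ 2 * (ν + Complex.I) * s) * ((‖ζ‖ ^ 2 : ℝ) : ℂ))) (𝓕⁻ φ)) y =
      ∫ x, gaussian (kernelParam ν / s) (y - x) * φ x := by
  have hb : 0 < (4 * (Real.pi : ℂ) ^ 2 * (ν + Complex.I) * s).re := by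
    rw [re_semigroup_coeff]
    positivity
  set η : Space n → ℂ := fun v => Complex.exp (-(4 * Real.pi ^ 2 * (ν + Complex.I) * s) *
      (‖v‖ : ℂ) ^ 2 + 2 * Real.pi * Complex.I * (inner ℝ (-y) v : ℝ)) with hη
  have hηi : Integrable η := GaussianFourier.integrable_cexp_neg_mul_sq_norm_add hb _ (-y)
  have hφi : Integrable fun x => φ (-x) := φ.integrable.comp_neg
  have h2 : ∫ w, 𝓕 η w • φ (-w) = ∫ v, η v • 𝓕 (fun x => φ (-x)) v := by
    simpa using! VectorFourier.integral_bilin_fourierIntegral_eq_flip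
      (ContinuousLinearMap.lsmul ℂ ℂ) (L := innerₗ (Space n)) Real.continuous_fourierChar
      continuous_inner hηi hφi
  rw [SchwartzMap.fourier_coe, Real.fourier_eq']
  calc _ = ∫ v, η v • 𝓕 (fun x => φ (-x)) v := by
        refine integral_congr_ae (Eventually.of_forall fun v => ?_)
        simp only [SchwartzMap.smulLeftCLM_apply_apply
          (hasTemperateGrowth_semigroup_symbol hν hs.le), smul_eq_mul, SchwartzMap.fourierInv_coe,
          Real.fourierInv_eq_fourier_comp_neg, hη, Complex.exp_add]
        rw [← mul_assoc, mul_comm (Complex.exp _) (Complex.exp _)]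
        congr 3
        · push_cast
          rfl
        · rw [inner_neg_left, real_inner_comm]
          push_cast
          ring
    _ = ∫ w, gaussian (kernelParam ν / s) (y - (-w)) * φ (-w) := by
        rw [← h2]
        refine integral_congr_ae (Eventually.of_forall fun w => ?_)
        simp only [hη, fourier_semigroup_symbol hν hs, smul_eq_mul]
        rw [← gaussian_neg]
        congr 2
        abel
    _ = _ := integral_neg_eq_self (fun w => gaussian (kernelParam ν / s) (y - w) * φ w) volume

variable {d : ℕ}

/-- Integration by parts in `x_i`: the kernel at `x - y` is the derivative in `x` of the even
Gaussian at `y - x`. -/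
lemma integral_gaussian_mul_lineDeriv {γ : ℂ} (hγ : 0 < γ.re) {s : ℝ} (hs : 0 < s)
    (i : Fin (d + 1)) (φ : 𝓢(Space (d + 1), ℂ)) (y : Space (d + 1)) :
    ∫ x, gaussian (γ / s) (y - x) * (-∂_{EuclideanSpace.single i (1 : ℝ)} φ) x =
      ∫ x, kernel γ i s (x - y) * φ x := by
  have hc := re_div_ofReal_pos hγ hs
  set v : Space (d + 1) := EuclideanSpace.single i (1 : ℝ) with hv
  set c := γ / (s : ℂ) with hcdef
  set B := ‖(c / Real.pi) ^ (((d + 1 : ℕ) : ℂ) / 2)‖ with hB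
  have hg : ∀ x, HasFDerivAt (fun x => gaussian c (y - x)) ((-(2 * c) * gaussian c (y - x)) •
      Complex.ofRealCLM.comp (innerSL ℝ (y - x)) |>.comp
        (-ContinuousLinearMap.id ℝ (Space (d + 1)))) x := fun x =>
    (hasFDerivAt_gaussian c (y - x)).comp x ((hasFDerivAt_id x).const_sub y)
  have hfd : ∀ x, fderiv ℝ (fun x => gaussian c (y - x)) x v = kernel γ i s (x - y) := by
    intro x
    rw [(hg x).fderiv, kernel, if_pos hs, ← hcdef, ← gaussian_neg c (x - y), neg_sub]
    simp [hv, EuclideanSpace.inner_single_right]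
    ring
  have hcont : Continuous fun x => gaussian c (y - x) :=
    (continuous_gaussian c).comp (continuous_const.sub continuous_id)
  have hbd : ∀ x, ‖gaussian c (y - x)‖ ≤ B := fun x => norm_gaussian_le hc _
  have hint : ∀ ψ : 𝓢(Space (d + 1), ℂ), Integrable fun x => gaussian c (y - x) * ψ x :=
    fun ψ => ψ.integrable.bdd_mul hcont.aestronglyMeasurable (Eventually.of_forall hbd)
  have hk : Integrable fun x => fderiv ℝ (fun x => gaussian c (y - x)) x v * φ x := by
    simp only [hfd]
    have h1 := (φ.integrable_pow_mul volume 1).add (φ.integrable.norm.const_mul ‖y‖)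
    refine (h1.const_mul (2 * ‖c‖ * B)).mono' (((measurable_kernel γ i).comp
      (measurable_const.prodMk (measurable_id.sub_const y))).aestronglyMeasurable.mul
        φ.continuous.aestronglyMeasurable) (Eventually.of_forall fun x => ?_)
    rw [kernel, if_pos hs, ← hcdef, norm_mul, norm_mul, norm_neg, norm_mul, norm_mul,
      Complex.norm_two, Complex.norm_real]
    have h2 : ‖(x - y) i‖ ≤ ‖x‖ + ‖y‖ := (PiLp.norm_apply_le (x - y) i).trans (norm_sub_le _ _)
    have h3 : ‖gaussian c (x - y)‖ ≤ B := norm_gaussian_le hc _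
    calc 2 * ‖c‖ * ‖(x - y) i‖ * ‖gaussian c (x - y)‖ * ‖φ x‖
        ≤ 2 * ‖c‖ * (‖x‖ + ‖y‖) * B * ‖φ x‖ := by gcongr
      _ = 2 * ‖c‖ * B * (‖x‖ ^ 1 * ‖φ x‖ + ‖y‖ * ‖φ x‖) := by ring
  have hφ : ∀ x, (-∂_{v} φ) x = -(fderiv ℝ φ x v) := fun x => by
    rw [neg_apply, SchwartzMap.lineDerivOp_apply_eq_fderiv]
  have hgφ : Integrable fun x => gaussian c (y - x) * fderiv ℝ φ x v := by
    simpa only [SchwartzMap.lineDerivOp_apply_eq_fderiv] using hint (∂_{v} φ)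
  have key := integral_mul_fderiv_eq_neg_fderiv_mul_of_integrable hk hgφ (hint φ)
    (fun x _ => (hg x).differentiableAt) (fun x _ => φ.differentiableAt)
  simp only [hφ, mul_neg, integral_neg, key, neg_neg, hfd]

/-- The action of `G_ν(s) ∂_{x_i}` on a tempered distribution given by a function. -/
theorem semigroup_partialDeriv_apply {ν s : ℝ} (hν : 0 < ν) (hs : 0 < s) (i : Fin (d + 1))
    {T : 𝓢'(Space (d + 1), ℂ)} {h : Space (d + 1) → ℂ} (hT : IsGivenBy T h)
    (φ : 𝓢(Space (d + 1), ℂ)) :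
    semigroup ν s (partialDeriv i T) φ =
      ∫ y, (∫ x, kernel (kernelParam ν) i s (x - y) * φ x) * h y := by
  rw [semigroup_eq, multiplier_partialDeriv_comm (hasTemperateGrowth_semigroup_symbol hν hs.le),
    partialDeriv, TemperedDistribution.lineDerivOp_apply_apply,
    TemperedDistribution.fourierMultiplierCLM_apply_apply, (hT _).2]
  simp only [fourier_smul_fourierInv_apply hν hs,
    integral_gaussian_mul_lineDeriv (re_kernelParam_pos hν) hs]

end Kernel
end GinzburgLandau

/-! ### Space-time convolution in the coordinates `(x_i, (t, x'))`. -/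

namespace GinzburgLandau

open Filter Topology

variable {d : ℕ}

/-- The point of space-time with `x_i = s` and remaining coordinates `(t, x')`. -/
def slicePoint (i : Fin (d + 1)) : ℝ × (ℝ × (Fin d → ℝ)) ≃ᵐ ℝ × Space (d + 1) :=
  ((MeasurableEquiv.prodAssoc.symm.trans
    ((MeasurableEquiv.prodComm (α := ℝ) (β := ℝ)).prodCongr
      (MeasurableEquiv.refl (Fin d → ℝ)))).trans
      MeasurableEquiv.prodAssoc).trans ((MeasurableEquiv.refl ℝ).prodCongr (insertPoint i))

lemma slicePoint_apply (i : Fin (d + 1)) (p : ℝ × (ℝ × (Fin d → ℝ))) :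
    slicePoint i p = (p.2.1, insertPoint i (p.1, p.2.2)) := rfl

lemma slicePoint_sub (i : Fin (d + 1)) (p q : ℝ × (ℝ × (Fin d → ℝ))) :
    slicePoint i (p - q) = slicePoint i p - slicePoint i q := by
  simp [slicePoint_apply, ← insertPoint_sub]

lemma measurePreserving_slicePoint (i : Fin (d + 1)) (ρ : Measure ℝ) [SFinite ρ] :
    MeasurePreserving (slicePoint i)
      ((volume : Measure ℝ).prod (ρ.prod (volume : Measure (Fin d → ℝ))))
      (ρ.prod (volume : Measure (Space (d + 1)))) := by
  have h1 := (measurePreserving_prodAssoc (volume : Measure ℝ) ρ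
    (volume : Measure (Fin d → ℝ))).symm
  have h2 := (Measure.measurePreserving_swap (μ := (volume : Measure ℝ)) (ν := ρ)).prod
    (MeasurePreserving.id (volume : Measure (Fin d → ℝ)))
  have h3 := measurePreserving_prodAssoc ρ (volume : Measure ℝ)
    (volume : Measure (Fin d → ℝ))
  have h4 := (MeasurePreserving.id ρ).prod (measurePreserving_insertPoint i)
  exact h4.comp (h3.comp (h2.comp h1))

instance isAddLeftInvariant_volume_prod_pi :
    (volume : Measure (ℝ × (Fin d → ℝ))).IsAddLeftInvariant :=
  inferInstanceAs ((volume : Measure ℝ).prod (volume : Measure (Fin d → ℝ))).IsAddLeftInvariant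

instance isNegInvariant_volume_prod_pi :
    (volume : Measure (ℝ × (Fin d → ℝ))).IsNegInvariant :=
  Measure.IsNegInvariant.mk (by
    have h := (Measure.measurePreserving_neg (volume : Measure ℝ)).prod
      (Measure.measurePreserving_neg (volume : Measure (Fin d → ℝ)))
    exact h.map_eq)

/-- The mixed norm of a function on the whole space-time. -/
def sliceNorm (i : Fin (d + 1)) (Φ : ℝ × Space (d + 1) → ℂ) : ℝ≥0∞ :=
  ∫⁻ s, eLpNorm (fun q => Φ (slicePoint i (s, q))) 2 volume

/-- The convolution of the kernel with a function on space-time. -/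
def duhamel (γ : ℂ) (i : Fin (d + 1)) (Φ : ℝ × Space (d + 1) → ℂ) (p : ℝ × Space (d + 1)) : ℂ :=
  ∫ p', kernel γ i (p.1 - p'.1) (p.2 - p'.2) * Φ p'

/-- The convolution of the absolute values of the kernel and of a function on space-time. -/
def duhamelAbs (γ : ℂ) (i : Fin (d + 1)) (Φ : ℝ × Space (d + 1) → ℂ) (p : ℝ × Space (d + 1)) :
    ℝ≥0∞ :=
  ∫⁻ p', ‖kernel γ i (p.1 - p'.1) (p.2 - p'.2) * Φ p'‖ₑ

section Estimates

variable {γ : ℂ} {i : Fin (d + 1)} {Φ : ℝ × Space (d + 1) → ℂ}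

lemma measurable_duhamel_integrand (γ : ℂ) (i : Fin (d + 1)) (hΦ : Measurable Φ) :
    Measurable fun x : (ℝ × Space (d + 1)) × (ℝ × Space (d + 1)) =>
      kernel γ i (x.1.1 - x.2.1) (x.1.2 - x.2.2) * Φ x.2 := by
  have h1 : Measurable fun x : (ℝ × Space (d + 1)) × (ℝ × Space (d + 1)) =>
      (x.1.1 - x.2.1, x.1.2 - x.2.2) :=
    (measurable_fst.fst.sub measurable_snd.fst).prodMk (measurable_fst.snd.sub measurable_snd.snd)
  exact ((measurable_kernel γ i).comp h1).mul (hΦ.comp measurable_snd)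

lemma stronglyMeasurable_duhamel (hΦ : Measurable Φ) : StronglyMeasurable (duhamel γ i Φ) :=
  (measurable_duhamel_integrand γ i hΦ).stronglyMeasurable.integral_prod_right

lemma measurable_duhamelAbs (hΦ : Measurable Φ) : Measurable (duhamelAbs γ i Φ) :=
  Measurable.lintegral_prod_right' (measurable_duhamel_integrand γ i hΦ).enorm

lemma kernel_slicePoint_sub (p q : ℝ × (ℝ × (Fin d → ℝ))) :
    kernel γ i ((slicePoint i p).1 - (slicePoint i q).1) ((slicePoint i p).2 - (slicePoint i q).2) =
      kernelSlice γ i (p.1 - q.1) (p.2 - q.2) := by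
  rw [← Prod.fst_sub, ← Prod.snd_sub, ← slicePoint_sub]
  rfl

lemma duhamel_slicePoint (p : ℝ × (ℝ × (Fin d → ℝ))) :
    duhamel γ i Φ (slicePoint i p) = ∫ q : ℝ × (ℝ × (Fin d → ℝ)),
      kernelSlice γ i (p.1 - q.1) (p.2 - q.2) * Φ (slicePoint i (q.1, q.2))
        ∂(volume.prod volume) := by
  rw [duhamel, Measure.volume_eq_prod, ← (measurePreserving_slicePoint i volume).integral_comp']
  simp only [kernel_slicePoint_sub, Prod.mk.eta]
  rfl

lemma duhamelAbs_slicePoint (p : ℝ × (ℝ × (Fin d → ℝ))) :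
    duhamelAbs γ i Φ (slicePoint i p) = ∫⁻ q : ℝ × (ℝ × (Fin d → ℝ)),
      ‖kernelSlice γ i (p.1 - q.1) (p.2 - q.2) * Φ (slicePoint i (q.1, q.2))‖ₑ
        ∂(volume.prod volume) := by
  rw [duhamelAbs, Measure.volume_eq_prod,
    ← (measurePreserving_slicePoint i volume).lintegral_comp_emb (slicePoint i).measurableEmbedding]
  simp only [kernel_slicePoint_sub, Prod.mk.eta]
  rfl

lemma measurable_comp_slicePoint (hΦ : Measurable Φ) :
    Measurable (Function.uncurry fun (s : ℝ) (q : ℝ × (Fin d → ℝ)) => Φ (slicePoint i (s, q))) :=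
  hΦ.comp (slicePoint i).measurable

/-- Only the finiteness of `K` and its independence of `s` matter: this makes the Duhamel integral
absolutely convergent. -/
lemma exists_eLpNorm_duhamelAbs_le (hγ : 0 < γ.re) (hΦ : Measurable Φ) :
    ∃ K : ℝ≥0∞, K ≠ ∞ ∧ ∀ s,
      eLpNorm (fun q => duhamelAbs γ i Φ (slicePoint i (s, q))) 2 volume ≤ K * sliceNorm i Φ := by
  refine ⟨ENNReal.ofReal (‖2 * γ * (γ / Real.pi) ^ (1 / 2 : ℂ)‖ *
      √(Real.pi / γ.re) * (‖γ‖ / γ.re) ^ ((d : ℝ) / 2)), ENNReal.ofReal_ne_top, fun s => ?_⟩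
  simp only [duhamelAbs_slicePoint]
  exact eLpNorm_mixed_lintegral_le (κ := kernelSlice γ i) (measurable_kernelSlice γ i)
    (measurable_comp_slicePoint hΦ) (lintegral_enorm_kernelSlice_le hγ i) s

lemma eLpNorm_duhamel_le (hγ : 0 < γ.re) (hΦ : Measurable Φ) (hN : sliceNorm i Φ ≠ ∞) (s : ℝ) :
    eLpNorm (fun q => duhamel γ i Φ (slicePoint i (s, q))) 2 volume ≤
      ENNReal.ofReal (2 * ‖γ‖) * sliceNorm i Φ := by
  simp only [duhamel_slicePoint]
  exact eLpNorm_mixed_integral_le (κ := kernelSlice γ i) (measurable_kernelSlice γ i)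
    (measurable_comp_slicePoint hΦ) (lintegral_enorm_kernelSlice_le hγ i) ENNReal.ofReal_ne_top
    (fun r f hf hf2 => eLpNorm_conv_le_of_norm_integral_cexp_le
      (measurable_kernelSlice_right γ i r) (integrable_kernelSlice hγ i r)
      (norm_integral_kernelSlice_le hγ i r) hf hf2) hN s

/-- A weight that is integrable on `ℝ^{d+1}` and dominates all Schwartz functions. -/
def weight (x : Space (d + 1)) : ℝ := (1 + ‖x‖) ^ (-((d + 3 : ℕ) : ℝ))

lemma weight_nonneg (x : Space (d + 1)) : 0 ≤ weight x :=
  Real.rpow_nonneg (by positivity) _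

lemma integrable_weight : Integrable (weight (d := d)) :=
  integrable_one_add_norm (by simp)

lemma measurable_weight : Measurable (weight (d := d)) := by
  unfold weight
  fun_prop

lemma exists_norm_le_mul_weight (φ : 𝓢(Space (d + 1), ℂ)) :
    ∃ C : ℝ, 0 ≤ C ∧ ∀ x, ‖φ x‖ ≤ C * weight x := by
  refine ⟨2 ^ (d + 3) * ((Finset.Iic (d + 3, 0)).sup fun m => SchwartzMap.seminorm ℝ m.1 m.2) φ,
    by positivity, fun x => ?_⟩
  · have h := SchwartzMap.one_add_le_sup_seminorm_apply (𝕜 := ℝ) (m := (d + 3, 0)) le_rfl le_rfl φ x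
    rw [norm_iteratedFDeriv_zero] at h
    rw [weight, Real.rpow_neg (by positivity), Real.rpow_natCast, ← div_eq_mul_inv,
      le_div_iff₀ (by positivity), mul_comm]
    exact h

lemma weight_slicePoint_le (p : ℝ × (ℝ × (Fin d → ℝ))) :
    weight (slicePoint i p).2 ≤ (1 + ‖p.1‖) ^ (-2 : ℝ) := by
  have h1 : ‖p.1‖ ≤ ‖(slicePoint i p).2‖ := by
    refine le_trans (le_of_eq ?_) (PiLp.norm_apply_le (slicePoint i p).2 i)
    simp [slicePoint_apply, insertPoint_apply]
  calc weight (slicePoint i p).2 ≤ (1 + ‖(slicePoint i p).2‖) ^ (-2 : ℝ) := by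
        refine Real.rpow_le_rpow_of_exponent_le (by linarith [norm_nonneg (slicePoint i p).2]) ?_
        push_cast
        linarith
    _ ≤ _ := Real.rpow_le_rpow_of_nonpos (by positivity) (by linarith) (by norm_num)

lemma lintegral_one_add_norm_lt_top :
    ∫⁻ s : ℝ, ENNReal.ofReal ((1 + ‖s‖) ^ (-2 : ℝ)) < ∞ := by
  have h : Integrable fun s : ℝ => (1 + ‖s‖) ^ (-2 : ℝ) := integrable_one_add_norm (by simp)
  have h2 := h.2
  rw [hasFiniteIntegral_iff_ofReal (Eventually.of_forall fun s =>
    Real.rpow_nonneg (by positivity) _)] at h2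
  exact h2

lemma lintegral_weight_lt_top : ∫⁻ x : Space (d + 1), ENNReal.ofReal (weight x) < ∞ := by
  have h2 := (integrable_weight (d := d)).2
  rwa [hasFiniteIntegral_iff_ofReal (Eventually.of_forall weight_nonneg)] at h2

/-- For almost every time the Duhamel integral converges absolutely when tested against the
weight. -/
lemma ae_lintegral_weight_mul_duhamelAbs (hγ : 0 < γ.re) (hΦ : Measurable Φ)
    (hN : sliceNorm i Φ ≠ ∞) :
    ∀ᵐ t : ℝ, ∫⁻ x, ENNReal.ofReal (weight x) * duhamelAbs γ i Φ (t, x) < ∞ := by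
  obtain ⟨K, hK, hW⟩ := exists_eLpNorm_duhamelAbs_le (i := i) hγ hΦ
  set W := duhamelAbs γ i Φ with hWdef
  have hWm : Measurable W := measurable_duhamelAbs hΦ
  set ω : Space (d + 1) → ℝ≥0∞ := fun x => ENNReal.ofReal (weight x) with hω
  have hωm : Measurable ω := measurable_weight.ennreal_ofReal
  set τ : ℝ → ℝ≥0∞ := fun s => ENNReal.ofReal ((1 + ‖s‖) ^ (-2 : ℝ)) with hτ
  have hτm : Measurable τ := by fun_prop
  have hτ1 : ∀ s, τ s ≤ 1 := fun s => ENNReal.ofReal_le_one.2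
    (Real.rpow_le_one_of_one_le_of_nonpos (by linarith [norm_nonneg s]) (by norm_num))
  -- On each slice `x_i = s` the square integral of `W` is bounded uniformly in `s`, and the weight
  -- is at most the integrable function `τ s`.
  have hsq : ∫⁻ p : ℝ × Space (d + 1), ω p.2 * W p ^ 2 < ∞ := by
    rw [Measure.volume_eq_prod,
      ← (measurePreserving_slicePoint i volume).lintegral_comp_emb
        (slicePoint i).measurableEmbedding, lintegral_prod _ (by
          exact (((hωm.comp measurable_snd).mul (hWm.pow_const 2)).comp
            (slicePoint i).measurable).aemeasurable)]
    calc ∫⁻ s : ℝ, ∫⁻ q, ω (slicePoint i (s, q)).2 * W (slicePoint i (s, q)) ^ 2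
        ≤ ∫⁻ s : ℝ, τ s * (K * sliceNorm i Φ) ^ 2 := by
          refine lintegral_mono fun s => ?_
          calc ∫⁻ q, ω (slicePoint i (s, q)).2 * W (slicePoint i (s, q)) ^ 2
              ≤ ∫⁻ q, τ s * W (slicePoint i (s, q)) ^ 2 := by
                refine lintegral_mono fun q => ?_
                gcongr
                exact ENNReal.ofReal_le_ofReal (weight_slicePoint_le (s, q))
            _ = τ s * ∫⁻ q, W (slicePoint i (s, q)) ^ 2 :=
                lintegral_const_mul _ ((hWm.comp ((slicePoint i).measurable.comp
                  measurable_prodMk_left)).pow_const 2)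
            _ ≤ _ := by
                gcongr
                have h := hW s
                rw [eLpNorm_two_eq_lintegral] at h
                simp only [enorm_eq_self] at h
                calc ∫⁻ q, W (slicePoint i (s, q)) ^ 2
                    = ((∫⁻ q, W (slicePoint i (s, q)) ^ 2) ^ (1 / 2 : ℝ)) ^ 2 := by
                      rw [← ENNReal.rpow_natCast, ← ENNReal.rpow_mul]
                      norm_num
                  _ ≤ _ := by gcongr
      _ = (∫⁻ s : ℝ, τ s) * (K * sliceNorm i Φ) ^ 2 := lintegral_mul_const _ hτm
      _ < ∞ := ENNReal.mul_lt_top lintegral_one_add_norm_lt_top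
          (ENNReal.pow_lt_top (ENNReal.mul_lt_top hK.lt_top hN.lt_top))
  -- The inequality `W ≤ 1 + W²` passes from the square to the first power; the factor `τ t` makes
  -- the constant term integrable in time, and is positive, so it can be removed at a fixed `t`.
  have hfin : ∫⁻ t : ℝ, ∫⁻ x, τ t * (ω x * W (t, x)) < ∞ := by
    have hm1 : Measurable fun p : ℝ × Space (d + 1) => τ p.1 * ω p.2 :=
      (hτm.comp measurable_fst).mul (hωm.comp measurable_snd)
    have hm2 : Measurable fun p : ℝ × Space (d + 1) => ω p.2 * W p ^ 2 :=
      (hωm.comp measurable_snd).mul (hWm.pow_const 2)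
    calc ∫⁻ t : ℝ, ∫⁻ x, τ t * (ω x * W (t, x))
        ≤ ∫⁻ t : ℝ, ∫⁻ x, (τ t * ω x + ω x * W (t, x) ^ 2) := by
          refine lintegral_mono fun t => lintegral_mono fun x => ?_
          rcases le_total (W (t, x)) 1 with h | h
          · refine le_trans ?_ le_self_add
            exact mul_le_mul_right (mul_le_of_le_one_right' h) _
          · refine le_trans (mul_le_of_le_one_left' (hτ1 t)) (le_trans ?_ le_add_self)
            exact mul_le_mul_right (le_self_pow h two_ne_zero) _
      _ = ∫⁻ p : ℝ × Space (d + 1), (τ p.1 * ω p.2 + ω p.2 * W p ^ 2) := by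
          exact (lintegral_prod _ (hm1.add hm2).aemeasurable).symm
      _ = (∫⁻ t, τ t) * (∫⁻ x, ω x) + ∫⁻ p : ℝ × Space (d + 1), ω p.2 * W p ^ 2 := by
          rw [lintegral_add_left hm1, Measure.volume_eq_prod,
            lintegral_prod_mul hτm.aemeasurable hωm.aemeasurable]
      _ < ∞ := ENNReal.add_lt_top.2 ⟨ENNReal.mul_lt_top lintegral_one_add_norm_lt_top
          lintegral_weight_lt_top, hsq⟩
  have hm : Measurable fun t : ℝ => ∫⁻ x, τ t * (ω x * W (t, x)) :=
    Measurable.lintegral_prod_right' (f := fun p : ℝ × Space (d + 1) =>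
      τ p.1 * (ω p.2 * W p)) ((hτm.comp measurable_fst).mul ((hωm.comp measurable_snd).mul hWm))
  filter_upwards [ae_lt_top hm hfin.ne] with t ht
  have hmt : Measurable fun x => ω x * W (t, x) := hωm.mul (hWm.comp measurable_prodMk_left)
  rw [lintegral_const_mul _ hmt] at ht
  have hτ0 : τ t ≠ 0 := by
    rw [hτ, ne_eq, ENNReal.ofReal_eq_zero, not_le]
    positivity
  by_contra h0
  rw [not_lt, top_le_iff] at h0
  rw [h0, ENNReal.mul_top hτ0] at ht
  exact lt_irrefl _ ht

end Estimates
end GinzburgLandau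

namespace GinzburgLandau

open Filter Topology

variable {d : ℕ}

/-! ### Reduction to measurable functions on the whole space-time. -/

section Norms

variable {i : Fin (d + 1)} {Φ F : ℝ × Space (d + 1) → ℂ}

lemma anisoNorm_eq (p : ℝ≥0∞) (i : Fin (d + 1)) (F : ℝ × Space (d + 1) → ℂ) :
    anisoNorm p i F = eLpNorm (fun s : ℝ => eLpNorm (fun q => F (slicePoint i (s, q))) 2
      ((volume.restrict (Ioi (0 : ℝ))).prod volume)) p volume := by
  simp only [anisoNorm, slicePoint_apply, insertPoint_apply]

lemma restrict_Ioi_prod_volume {α : Type*} [MeasureSpace α] [SFinite (volume : Measure α)] :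
    (volume.restrict (Ioi (0 : ℝ))).prod (volume : Measure α) =
      (volume : Measure (ℝ × α)).restrict (Ioi (0 : ℝ) ×ˢ univ) := by
  rw [Measure.volume_eq_prod, ← Measure.prod_restrict, Measure.restrict_univ]

/-- A function that represents a family may be replaced by a measurable one, extended by zero to
negative times. -/
lemma exists_measurable_extension (i : Fin (d + 1))
    (hF : AEStronglyMeasurable F ((volume.restrict (Ioi (0 : ℝ))).prod volume)) :
    ∃ Φ : ℝ × Space (d + 1) → ℂ, Measurable Φ ∧ (∀ t x, t ≤ 0 → Φ (t, x) = 0) ∧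
      F =ᵐ[(volume.restrict (Ioi (0 : ℝ))).prod volume] Φ ∧
      sliceNorm i Φ ≤ anisoNorm 1 i F := by
  obtain ⟨H, hH, hFH⟩ := hF
  set Φ : ℝ × Space (d + 1) → ℂ := (Ioi (0 : ℝ) ×ˢ univ).indicator H with hΦ
  have hae : F =ᵐ[(volume.restrict (Ioi (0 : ℝ))).prod volume] Φ := by
    refine hFH.trans ?_
    rw [restrict_Ioi_prod_volume]
    exact (indicator_ae_eq_restrict (measurableSet_Ioi.prod MeasurableSet.univ)).symm
  have hzero : ∀ t x, t ≤ 0 → Φ (t, x) = 0 := fun t x ht =>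
    indicator_of_notMem (by simpa using ht) _
  refine ⟨Φ, hH.measurable.indicator
    (measurableSet_Ioi.prod MeasurableSet.univ), hzero, hae, ?_⟩
  rw [anisoNorm_eq, eLpNorm_one_eq_lintegral_enorm, sliceNorm]
  have h1 := (measurePreserving_slicePoint i
    (volume.restrict (Ioi (0 : ℝ)))).quasiMeasurePreserving.ae_eq_comp hae
  refine lintegral_mono_ae ?_
  filter_upwards [Measure.ae_ae_of_ae_prod h1] with s hs
  rw [enorm_eq_self, eLpNorm_congr_ae (f := fun q => F (slicePoint i (s, q))) hs,
    restrict_Ioi_prod_volume,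
    ← eLpNorm_indicator_eq_eLpNorm_restrict (measurableSet_Ioi.prod MeasurableSet.univ)]
  refine le_of_eq (congrArg (fun f => eLpNorm f 2 volume) ?_)
  ext q
  by_cases hq : 0 < q.1
  · rw [indicator_of_mem (by simpa using hq)]
    rfl
  · rw [indicator_of_notMem (by simpa using hq)]
    exact hzero _ _ (not_lt.1 hq)

lemma anisoNorm_top_duhamel_le {γ : ℂ} (hγ : 0 < γ.re) (hΦ : Measurable Φ)
    (hN : sliceNorm i Φ ≠ ∞) :
    anisoNorm ∞ i (duhamel γ i Φ) ≤ ENNReal.ofReal (2 * ‖γ‖) * sliceNorm i Φ := by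
  rw [anisoNorm_eq, eLpNorm_exponent_top]
  refine essSup_le_of_ae_le _ (Eventually.of_forall fun s => ?_)
  simp only [enorm_eq_self]
  refine le_trans (eLpNorm_mono_measure _ ?_) (eLpNorm_duhamel_le hγ hΦ hN s)
  rw [restrict_Ioi_prod_volume]
  exact Measure.restrict_le_self

end Norms

/-! ### Identification of the weak Duhamel integral with the convolution. -/

section Representation

variable {i : Fin (d + 1)} {Φ : ℝ × Space (d + 1) → ℂ}

lemma integrable_prod_kernel {γ : ℂ} (hΦ : Measurable Φ) {t : ℝ}
    (ht : ∫⁻ x, ENNReal.ofReal (weight x) * duhamelAbs γ i Φ (t, x) < ∞)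
    (φ : 𝓢(Space (d + 1), ℂ)) :
    Integrable (fun y : Space (d + 1) × (ℝ × Space (d + 1)) =>
      φ y.1 * (kernel γ i (t - y.2.1) (y.1 - y.2.2) * Φ y.2)) (volume.prod volume) := by
  have hm : Measurable fun y : Space (d + 1) × (ℝ × Space (d + 1)) =>
      kernel γ i (t - y.2.1) (y.1 - y.2.2) * Φ y.2 := by
    have h1 : Measurable fun y : Space (d + 1) × (ℝ × Space (d + 1)) =>
        (t - y.2.1, y.1 - y.2.2) :=
      (measurable_const.sub measurable_snd.fst).prodMk (measurable_fst.sub measurable_snd.snd)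
    exact ((measurable_kernel γ i).comp h1).mul (hΦ.comp measurable_snd)
  have hm2 : Measurable fun y : Space (d + 1) × (ℝ × Space (d + 1)) =>
      φ y.1 * (kernel γ i (t - y.2.1) (y.1 - y.2.2) * Φ y.2) :=
    (φ.continuous.measurable.comp measurable_fst).mul hm
  obtain ⟨C, hC, hφ⟩ := exists_norm_le_mul_weight φ
  refine ⟨hm2.aestronglyMeasurable, ?_⟩
  rw [HasFiniteIntegral, lintegral_prod _ hm2.enorm.aemeasurable]
  refine lt_of_le_of_lt ?_ (ENNReal.mul_lt_top (ENNReal.ofReal_lt_top (r := C)) ht)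
  have hm3 : Measurable fun x => ENNReal.ofReal (weight x) * duhamelAbs γ i Φ (t, x) :=
    measurable_weight.ennreal_ofReal.mul ((measurable_duhamelAbs hΦ).comp measurable_prodMk_left)
  rw [← lintegral_const_mul _ hm3]
  refine lintegral_mono fun x => ?_
  simp only [enorm_mul (φ x)]
  have hmx : Measurable fun y : ℝ × Space (d + 1) =>
      kernel γ i (t - y.1) (x - y.2) * Φ y := hm.comp measurable_prodMk_left
  rw [lintegral_const_mul _ hmx.enorm, ← mul_assoc, ← ENNReal.ofReal_mul hC, ← ofReal_norm]
  exact mul_le_mul_left (ENNReal.ofReal_le_ofReal (hφ x)) _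

/-- Fubini puts the test function inside, next to the kernel, which is the form produced by
`semigroup_partialDeriv_apply`. -/
lemma integral_kernel_swap {γ : ℂ} (hΦ : Measurable Φ) {t : ℝ}
    (ht : ∫⁻ x, ENNReal.ofReal (weight x) * duhamelAbs γ i Φ (t, x) < ∞)
    (φ : 𝓢(Space (d + 1), ℂ)) :
    ∫ x, φ x * duhamel γ i Φ (t, x) =
      ∫ τ, ∫ y, (∫ x, kernel γ i (t - τ) (x - y) * φ x) * Φ (τ, y) := by
  have hi := integrable_prod_kernel hΦ ht φ
  simp only [duhamel, ← integral_const_mul]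
  rw [integral_integral_swap hi, Measure.volume_eq_prod, integral_prod _ hi.integral_prod_right]
  refine integral_congr_ae (Eventually.of_forall fun τ =>
    integral_congr_ae (Eventually.of_forall fun y => ?_))
  simp only
  rw [← integral_mul_const]
  refine integral_congr_ae (Eventually.of_forall fun x => ?_)
  simp only
  ring

/-- The Duhamel term of a family given by a function is given by the convolution with the
kernel. -/
theorem represents_box_duhamel {σ : (Fin (d + 1) → ℤ) → Space (d + 1) → ℝ}
    (hσ : IsUniformPartition σ) (k : Fin (d + 1) → ℤ) {ν : ℝ} (hν : 0 < ν)
    {f u : ℝ → 𝓢'(Space (d + 1), ℂ)} (hu : IsDuhamel ν (fun τ => partialDeriv i (f τ)) u)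
    (hΦ : Measurable Φ) (hzero : ∀ t x, t ≤ 0 → Φ (t, x) = 0) (hN : sliceNorm i Φ ≠ ∞)
    (hf : ∀ᵐ τ ∂(volume.restrict (Ioi (0 : ℝ))), IsGivenBy (box σ k (f τ)) fun x => Φ (τ, x)) :
    Represents (duhamel (kernelParam ν) i Φ) fun t => box σ k (u t) := by
  refine ⟨(stronglyMeasurable_duhamel hΦ).aestronglyMeasurable, ?_⟩
  filter_upwards [ae_restrict_of_ae (ae_lintegral_weight_mul_duhamelAbs (re_kernelParam_pos hν)
    hΦ hN), ae_restrict_mem measurableSet_Ioi] with t ht ht0 φ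
  have ht0' : (0 : ℝ) ≤ t := le_of_lt ht0
  constructor
  · simpa only [duhamel, ← integral_const_mul] using
      (integrable_prod_kernel hΦ ht φ).integral_prod_left
  -- Times `τ ≤ 0` contribute nothing because `Φ` vanishes there, and times `τ ≥ t` because the
  -- kernel is causal.
  · have hsupp : ∫ τ in Ioo 0 t,
        ∫ y, (∫ x, kernel (kernelParam ν) i (t - τ) (x - y) * φ x) * Φ (τ, y) =
        ∫ τ, ∫ y, (∫ x, kernel (kernelParam ν) i (t - τ) (x - y) * φ x) * Φ (τ, y) := by
      refine setIntegral_eq_integral_of_forall_compl_eq_zero fun τ hτ => ?_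
      rcases le_or_gt τ 0 with h | h
      · simp [hzero τ _ h]
      · have h2 : ¬ 0 < t - τ := fun h3 => hτ ⟨h, sub_pos.1 h3⟩
        simp only [kernel, if_neg h2, zero_mul, integral_zero]
    -- The multiplier `□_k` acts by its transpose on `φ`, and the weak integral is applied to that
    -- test function. The endpoint `τ = t` is dropped so that `t - τ > 0`, where the kernel formula
    -- holds.
    rw [integral_kernel_swap hΦ ht φ, ← hsupp, box, multiplier,
      TemperedDistribution.fourierMultiplierCLM_apply_apply, (hu t ht0' _).2,
      intervalIntegral.integral_of_le ht0', integral_Ioc_eq_integral_Ioo]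
    refine setIntegral_congr_ae measurableSet_Ioo ?_
    filter_upwards [(ae_restrict_iff' measurableSet_Ioi).1 hf] with τ hτ hτt
    have hs : 0 < t - τ := sub_pos.2 hτt.2
    rw [← semigroup_partialDeriv_apply hν hs i (hτ hτt.1) φ,
      ← box_semigroup_partialDeriv hσ k hν hs.le]
    rfl

end Representation

end GinzburgLandau

end

theorem mainTheorem5 :
    ∃ C : ℝ, 0 < C ∧
      ∀ (d : ℕ) (σ : (Fin (d + 1) → ℤ) → GinzburgLandau.Space (d + 1) → ℝ),
        GinzburgLandau.IsUniformPartition σ →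
      ∀ (i : Fin (d + 1)) (k : Fin (d + 1) → ℤ) (ν : ℝ), 0 < ν →
      ∀ f u : ℝ → 𝓢'(GinzburgLandau.Space (d + 1), ℂ),
        GinzburgLandau.IsDuhamel ν (fun τ => GinzburgLandau.partialDeriv i (f τ)) u →
        GinzburgLandau.distNorm ∞ i (fun t => GinzburgLandau.box σ k (u t)) ≤
          ENNReal.ofReal C *
            GinzburgLandau.distNorm 1 i (fun t => GinzburgLandau.box σ k (f t)) := by
  -- The constant is `2 |γ|` with `|γ| = 1 / (4 |ν + i|) ≤ 1/4`.
  refine ⟨1 / 2, by norm_num, fun d σ hσ i k ν hν f u hu => ?_⟩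
  have hC0 : ENNReal.ofReal (1 / 2) ≠ 0 := by
    rw [ne_eq, ENNReal.ofReal_eq_zero]
    norm_num
  rw [GinzburgLandau.distNorm.eq_def 1]
  -- The positive finite constant passes through the infimum, so it suffices to treat each
  -- representing function `F`; if there is none, the right-hand side is `∞`.
  simp only [ENNReal.mul_iInf_of_ne hC0 ENNReal.ofReal_ne_top]
  refine le_iInf₂ fun F hF => ?_
  obtain ⟨Φ, hΦ, hzero, hae, hN⟩ := GinzburgLandau.exists_measurable_extension i hF.1
  rcases eq_or_ne (GinzburgLandau.anisoNorm 1 i F) ∞ with htop | htop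
  · rw [htop, ENNReal.mul_top hC0]
    exact le_top
  have hNt : GinzburgLandau.sliceNorm i Φ ≠ ∞ := ne_top_of_le_ne_top htop hN
  have hf : ∀ᵐ τ ∂(volume.restrict (Ioi (0 : ℝ))),
      GinzburgLandau.IsGivenBy (GinzburgLandau.box σ k (f τ)) fun x => Φ (τ, x) := by
    filter_upwards [hF.2, Measure.ae_ae_of_ae_prod hae] with τ h1 h2 φ
    have h3 : (fun x => φ x * F (τ, x)) =ᵐ[volume] fun x => φ x * Φ (τ, x) := by
      filter_upwards [h2] with x hx
      rw [hx]
    exact ⟨(h1 φ).1.congr h3, (h1 φ).2.trans (integral_congr_ae h3)⟩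
  have hγ := GinzburgLandau.re_kernelParam_pos hν
  calc GinzburgLandau.distNorm ∞ i (fun t => GinzburgLandau.box σ k (u t))
      ≤ GinzburgLandau.anisoNorm ∞ i
          (GinzburgLandau.duhamel (GinzburgLandau.kernelParam ν) i Φ) :=
        iInf₂_le (f := fun F (_ : GinzburgLandau.Represents F
          fun t => GinzburgLandau.box σ k (u t)) => GinzburgLandau.anisoNorm ∞ i F) _
          (GinzburgLandau.represents_box_duhamel hσ k hν hu hΦ hzero hNt hf)
    _ ≤ ENNReal.ofReal (2 * ‖GinzburgLandau.kernelParam ν‖) * GinzburgLandau.sliceNorm i Φ :=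
        GinzburgLandau.anisoNorm_top_duhamel_le hγ hΦ hNt
    _ ≤ ENNReal.ofReal (1 / 2) * GinzburgLandau.anisoNorm 1 i F :=
        mul_le_mul' (ENNReal.ofReal_le_ofReal
          (by linarith [GinzburgLandau.norm_kernelParam_le ν])) hN
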